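/- Let $U\subseteq\mathbb R^n$ and $V\subseteq\mathbb R^d$ be open, let $f:U\times V\to\mathbb R^n$ and $\Gamma:\mathbb R\to V$ be $C^1$, and suppose $\Gamma(t)\to\Gamma^\pm\in V$ as $t\to\pm\infty$. Let $g:\mathbb R\to(-1,1)$ be $C^2$ with $\dot g>0$, $g(t)\to\pm1$ and $\dot g(t)\to0$ as $t\to\pm\infty$, and let $h=g^{-1}:(-1,1)\to\mathbb R$. The compactified system on $U\times[-1,1]$ is $$\dot x=f(x,\Gamma(h(s))),\qquad \dot s=\gamma(s),$$ where $\gamma(s)=\dot g(h(s))=1/h'(s)$ for $s\in(-1,1)$, $\gamma(\pm1)=0$, and $\Gamma(h(\pm1)):=\Gamma^\pm$. Assume that its vector field is $C^1$ on $U\times[-1,1]$ (with one-sided derivatives in $s$ at $s=\pm1$). Let $\eta^-\in U$ be a hyperbolic sink of the past limit system $\dot x=f(x,\Gamma^-)$, that is, $f(\eta^-,\Gamma^-)=0$ and all eigenvalues of $\partial_xf(\eta^-,\Gamma^-)$ have negative real part. Suppose that $\tilde\eta^-=(\eta^-,-1)$ is a non-hyperbolic equilibrium (a non-hyperbolic saddle)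 of the compactified system, that is, its Jacobian $J$ at $\tilde\eta^-$ has an eigenvalue with zero real part. Let $E^s,E^c,E^u$ be the sums of the (real) generalized eigenspaces of $J$ for eigenvalues with negative, zero and positive real part. For an open neighbourhood $N$ of $\tilde\eta^-$, a *local centre manifold of $\tilde\eta^-$ relative to $N$* is a set $W\subseteq N\cap(U\times[-1,1])$ that is the graph $\{p+h^c(p)\}$ of a Lipschitz function $h^c:(\tilde\eta^-+E^c)\cap N\cap(U\times[-1,1])\to E^s\oplus E^u$, contains $\tilde\eta^-$ and is tangent to $\tilde\eta^-+E^c$ there (that is, $h^c(\tilde\eta^-)=0$ and $h^c$ has zero derivative at $\tilde\eta^-$ along its domain), and is flow-invariant relative to $N$: every orbit segment of the compactified system, in either direction of time, that starts in $W$ and stays in $N$ stays in $W$. The *local unstable set* $w^u_{loc}(\tilde\eta^-)$ relative to $N$ is the set of points $y$ whose backward orbit exists for all $t\le0$, stays in $N$ for all $t\le0$, and has its $\alpha$-limit set contained in $\{\tilde\eta^-\}$. Then there are arbitrarily small open neighbourhoods $N$ of $\tilde\eta^-$ (every neighbourhood of $\tilde\eta^-$ contains one) relative to which $\tilde\eta^-$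 has exactly one local centre manifold $W^c_{loc}(\tilde\eta^-)$, and $$W^c_{loc}(\tilde\eta^-)=w^u_{loc}(\tilde\eta^-).$$ -/

import Mathlib

open Set Filter Topology
open scoped TensorProduct NNReal

noncomputable section

/-! ## Linear algebra: complex eigenvalues and spectral subspaces of a real operator -/

/-- `μ : ℂ` is an eigenvalue of the real operator `L`, i.e. of its complexification. -/
def IsComplexEigenvalue {X : Type*} [AddCommGroup X] [Module ℝ X] (L : X →ₗ[ℝ] X) (μ : ℂ) :
    Prop :=
  Module.End.HasEigenvalue (L.baseChange ℂ : Module.End ℂ (ℂ ⊗[ℝ] X)) μ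

/-- The real subspace of vectors that lie, after complexification, in the sum of the generalized
eigenspaces of `L` for the eigenvalues in `S`. -/
def spectralSubspace {X : Type*} [AddCommGroup X] [Module ℝ X] (L : X →ₗ[ℝ] X) (S : Set ℂ) :
    Submodule ℝ X :=
  Submodule.comap (TensorProduct.mk ℝ ℂ X 1)
    ((⨆ μ ∈ S, Module.End.maxGenEigenspace
      (L.baseChange ℂ : Module.End ℂ (ℂ ⊗[ℝ] X)) μ).restrictScalars ℝ)

/-- `E^s`: eigenvalues with negative real part. -/
def stableSubspace {X : Type*} [AddCommGroup X] [Module ℝ X] (L : X →ₗ[ℝ] X) : Submodule ℝ X :=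
  spectralSubspace L {μ | μ.re < 0}

/-- `E^c`: eigenvalues with zero real part. -/
def centreSubspace {X : Type*} [AddCommGroup X] [Module ℝ X] (L : X →ₗ[ℝ] X) : Submodule ℝ X :=
  spectralSubspace L {μ | μ.re = 0}

/-- `E^u`: eigenvalues with positive real part. -/
def unstableSubspace {X : Type*} [AddCommGroup X] [Module ℝ X] (L : X →ₗ[ℝ] X) : Submodule ℝ X :=
  spectralSubspace L {μ | 0 < μ.re}

/-! ## Autonomous systems `y' = F y` on a phase space `P` -/

section Dynamics

variable {X : Type*} [NormedAddCommGroup X] [NormedSpace ℝ X]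

/-- `φ` solves `y' = F y` in the phase space `P` on the time interval `I`
(one-sided derivatives at end points of `I`). -/
def IsSolutionOn (F : X → X) (P : Set X) (φ : ℝ → X) (I : Set ℝ) : Prop :=
  ∀ t ∈ I, φ t ∈ P ∧ HasDerivWithinAt φ (F (φ t)) I t

/-- The `α`-limit set of a backward orbit `φ : (-∞, 0] → X`. -/
def alphaLimit (φ : ℝ → X) : Set X :=
  ⋂ T ∈ Iio (0 : ℝ), closure (φ '' Iio T)

/-- The local unstable set of `A` in `N`: the points `y` whose backward orbit exists for all
`t ≤ 0`, has its `α`-limit set inside `A`, and stays in `N` for all `t ≤ 0`. -/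
def localUnstableSet (F : X → X) (P : Set X) (A N : Set X) : Set X :=
  {y | ∃ φ : ℝ → X, φ 0 = y ∧ IsSolutionOn F P φ (Iic 0) ∧
    alphaLimit φ ⊆ A ∧ ∀ t ≤ 0, φ t ∈ N}

/-- `W` is flow-invariant relative to `N`: an orbit segment (in either direction of time) that
starts in `W` and stays in `N` stays in `W`. -/
def IsInvariantRelTo (F : X → X) (P : Set X) (N W : Set X) : Prop :=
  ∀ (φ : ℝ → X) (a b : ℝ), a ≤ 0 → 0 ≤ b → IsSolutionOn F P φ (Icc a b) → φ 0 ∈ W →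
    (∀ t ∈ Icc a b, φ t ∈ N) → ∀ t ∈ Icc a b, φ t ∈ W

/-- The Jacobian of the vector field at `y`. The phase space may have a boundary, so the
derivative is taken within `P`. -/
def jacobianAt (F : X → X) (P : Set X) (y : X) : X →ₗ[ℝ] X :=
  (fderivWithin ℝ F P y : X →L[ℝ] X)

/-- `y` is a hyperbolic sink: an equilibrium, all eigenvalues of the Jacobian have negative
real part. -/
def IsHyperbolicSink (F : X → X) (P : Set X) (y : X) : Prop :=
  y ∈ P ∧ F y = 0 ∧ ∀ μ : ℂ, IsComplexEigenvalue (jacobianAt F P y) μ → μ.re < 0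

/-- `y` is a non-hyperbolic equilibrium: some eigenvalue of the Jacobian has zero real part. -/
def IsNonhyperbolicEquilibrium (F : X → X) (P : Set X) (y : X) : Prop :=
  y ∈ P ∧ F y = 0 ∧ ∃ μ : ℂ, IsComplexEigenvalue (jacobianAt F P y) μ ∧ μ.re = 0

/-- The piece of the affine subspace `y + E^c` that lies in `N` and in the phase space. -/
def centreDomain (F : X → X) (P : Set X) (y : X) (N : Set X) : Set X :=
  {p | p ∈ P ∧ p ∈ N ∧ p - y ∈ centreSubspace (jacobianAt F P y)}

/-- `W` is a local centre manifold of the equilibrium `y` relative to `N`: the graph, contained in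
`N`, of a Lipschitz function `h` from `E^c ∩ N` (based at `y`) to `E^s ⊕ E^u`, that passes through
`y`, is tangent to `E^c` there, and is flow-invariant relative to `N`. -/
def IsLocalCentreManifold (F : X → X) (P : Set X) (y : X) (N W : Set X) : Prop :=
  (∃ (h : X → X) (K : ℝ≥0),
    LipschitzOnWith K h (centreDomain F P y N) ∧
    (∀ p ∈ centreDomain F P y N,
      h p ∈ stableSubspace (jacobianAt F P y) ⊔ unstableSubspace (jacobianAt F P y)) ∧
    h y = 0 ∧
    HasFDerivWithinAt h (0 : X →L[ℝ] X) (centreDomain F P y N) y ∧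
    W = (fun p => p + h p) '' centreDomain F P y N) ∧
  W ⊆ P ∩ N ∧
  IsInvariantRelTo F P N W

end Dynamics

/-! ## The two-sided compactification -/

/-- Coordinate transformations `s = g t` of the real line onto `(-1, 1)`. -/
structure IsCoordinateTransformation (g : ℝ → ℝ) : Prop where
  contDiff : ContDiff ℝ 2 g
  mem_Ioo : ∀ t, g t ∈ Ioo (-1 : ℝ) 1
  deriv_pos : ∀ t, 0 < deriv g t
  tendsto_atTop : Tendsto g atTop (𝓝 1)
  tendsto_atBot : Tendsto g atBot (𝓝 (-1))
  deriv_tendsto_atTop : Tendsto (deriv g) atTop (𝓝 0)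
  deriv_tendsto_atBot : Tendsto (deriv g) atBot (𝓝 0)

/-- The inverse transformation `h = g⁻¹`, meaningful on `(-1, 1)`. -/
def inverseTransformation (g : ℝ → ℝ) : ℝ → ℝ := Function.invFun g

/-- `Γ (h s)` on `(-1, 1)`, extended by the limits `Γ⁻` and `Γ⁺` of `Γ` to `s = -1` and `s = 1`. -/
def extendedGamma {d : ℕ} (g : ℝ → ℝ) (Γ : ℝ → EuclideanSpace ℝ (Fin d))
    (Γm Γp : EuclideanSpace ℝ (Fin d)) (s : ℝ) : EuclideanSpace ℝ (Fin d) :=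
  if s ≤ -1 then Γm else if 1 ≤ s then Γp else Γ (inverseTransformation g s)

/-- `γ s = g' (h s) = 1 / h' s` on `(-1, 1)`, extended by `0` to `s = ±1`. -/
def augmentedSpeed (g : ℝ → ℝ) (s : ℝ) : ℝ :=
  if s ≤ -1 then 0 else if 1 ≤ s then 0 else deriv g (inverseTransformation g s)

/-- The extended phase space `U × [-1, 1]`. -/
def extendedPhaseSpace {n : ℕ} (U : Set (EuclideanSpace ℝ (Fin n))) :
    Set (EuclideanSpace ℝ (Fin n) × ℝ) :=
  U ×ˢ Icc (-1 : ℝ) 1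

/-- The vector field of the compactified system `x' = f (x, Γ (h s))`, `s' = γ s`. Only its values
on `U × [-1, 1]` matter. -/
def compactifiedField {n d : ℕ}
    (f : EuclideanSpace ℝ (Fin n) → EuclideanSpace ℝ (Fin d) → EuclideanSpace ℝ (Fin n))
    (g : ℝ → ℝ) (Γ : ℝ → EuclideanSpace ℝ (Fin d)) (Γm Γp : EuclideanSpace ℝ (Fin d)) :
    EuclideanSpace ℝ (Fin n) × ℝ → EuclideanSpace ℝ (Fin n) × ℝ :=
  fun p => (f p.1 (extendedGamma g Γ Γm Γp p.2), augmentedSpeed g p.2)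

end

/-! The eigenvalues of the Jacobian `J` at `(η, -1)` are those of `A = ∂ₓf(η, Γ⁻)`, all in the open
left half-plane, and the real number `γ'(-1)`. Non-hyperbolicity forces `γ'(-1) = 0`; hence
`J (w, τ) = (A (w - τ v), 0)` for a vector `v`, the centre subspace is the line through `(v, 1)`, and
`E^s ⊕ E^u` is `ℝⁿ × 0` (`mem_centreSubspace_iff`, `mem_stable_sup_unstable_iff`).

Let `B` be an inner product on `ℝⁿ` for which `A` is strictly dissipative (`exists_lyapunov_form`).
Near the equilibrium, differences of solutions, with component `u` along `ℝⁿ` and `τ` along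
`(v, 1)`, satisfy the cone condition: `B(u, u) - (2ε/κ) τ²` decays like `exp (-κ t)`
(`IsDissipativeOn.tiltForm_sub_le`). Two backward orbits that stay near the equilibrium therefore
differ by a vector of the cone `B(u, u) ≤ (2ε/κ) τ²`, so that the points with a backward orbit in a
thin tube `N` around the centre direction form the graph of a Lipschitz function over the centre
line. The constant `ε` tends to `0` with the size of the neighbourhood, which gives tangency.

As `s = g t` solves the second equation, the graph is nonempty over each `s` because of a pullback
construction: solutions that start on the axis of the tube at times `t → -∞` stay in the tube and
converge to a solution defined for all past times
(`IsDissipativeSkewProduct.exists_backward_solution`). The same contraction gives uniqueness: the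
points of any centre manifold relative to `N` are reached by following the manifold forward from
arbitrarily early times, so they lie on the pullback limit
(`IsDissipativeSkewProduct.eq_backwardSet_of_isLocalCentreManifold`). Every backward orbit in `N`
converges to the equilibrium, so the graph is also the local unstable set
(`IsDissipativeSkewProduct.backwardSet_eq_localUnstableSet`). -/

/-! ### Spectral subspaces and the skew-product Jacobian -/

section SpectralSubspaces

variable {X Y : Type*} [AddCommGroup X] [Module ℝ X] [AddCommGroup Y] [Module ℝ Y]

lemma baseChange_apply_of_comp_eq {L : X →ₗ[ℝ] X} {L' : Y →ₗ[ℝ] Y} {C : X →ₗ[ℝ] Y}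
    (h : C ∘ₗ L = L' ∘ₗ C) (z : ℂ ⊗[ℝ] X) :
    C.baseChange ℂ (L.baseChange ℂ z) = L'.baseChange ℂ (C.baseChange ℂ z) := by
  have := congrArg (LinearMap.baseChange ℂ) h
  rw [LinearMap.baseChange_comp, LinearMap.baseChange_comp] at this
  exact LinearMap.congr_fun this z

lemma baseChange_mem_maxGenEigenspace {L : X →ₗ[ℝ] X} {L' : Y →ₗ[ℝ] Y} {C : X →ₗ[ℝ] Y}
    (h : C ∘ₗ L = L' ∘ₗ C) {μ : ℂ} {z : ℂ ⊗[ℝ] X}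
    (hz : z ∈ Module.End.maxGenEigenspace (L.baseChange ℂ : Module.End ℂ (ℂ ⊗[ℝ] X)) μ) :
    C.baseChange ℂ z ∈
      Module.End.maxGenEigenspace (L'.baseChange ℂ : Module.End ℂ (ℂ ⊗[ℝ] Y)) μ := by
  rw [Module.End.mem_maxGenEigenspace] at hz ⊢
  obtain ⟨k, hk⟩ := hz
  refine ⟨k, ?_⟩
  have key : ∀ (k : ℕ) (z : ℂ ⊗[ℝ] X),
      (((L'.baseChange ℂ : Module.End ℂ (ℂ ⊗[ℝ] Y)) - μ • 1) ^ k) (C.baseChange ℂ z) =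
      C.baseChange ℂ ((((L.baseChange ℂ : Module.End ℂ (ℂ ⊗[ℝ] X)) - μ • 1) ^ k) z) := by
    intro k
    induction k with
    | zero => intro z; simp
    | succ k ih =>
      intro z
      rw [pow_succ, pow_succ, Module.End.mul_apply, Module.End.mul_apply, ← ih]
      congr 1
      simp [baseChange_apply_of_comp_eq h]
  rw [key, hk, map_zero]

/-- A linear map that intertwines two operators maps spectral subspaces into spectral subspaces. -/
lemma map_mem_spectralSubspace {L : X →ₗ[ℝ] X} {L' : Y →ₗ[ℝ] Y} {C : X →ₗ[ℝ] Y}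
    (h : C ∘ₗ L = L' ∘ₗ C) {S : Set ℂ} {x : X} (hx : x ∈ spectralSubspace L S) :
    C x ∈ spectralSubspace L' S := by
  have hle : (⨆ μ ∈ S, Module.End.maxGenEigenspace
      (L.baseChange ℂ : Module.End ℂ (ℂ ⊗[ℝ] X)) μ) ≤
      (⨆ μ ∈ S, Module.End.maxGenEigenspace
      (L'.baseChange ℂ : Module.End ℂ (ℂ ⊗[ℝ] Y)) μ).comap (C.baseChange ℂ) := by
    refine iSup₂_le fun μ hμ z hz => ?_
    exact (le_iSup₂ (f := fun μ (_ : μ ∈ S) => Module.End.maxGenEigenspace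
      (L'.baseChange ℂ : Module.End ℂ (ℂ ⊗[ℝ] Y)) μ) μ hμ) (baseChange_mem_maxGenEigenspace h hz)
  have h2 : C.baseChange ℂ ((1 : ℂ) ⊗ₜ[ℝ] x) ∈ (⨆ μ ∈ S, Module.End.maxGenEigenspace
      (L'.baseChange ℂ : Module.End ℂ (ℂ ⊗[ℝ] Y)) μ) := hle hx
  rwa [LinearMap.baseChange_tmul] at h2

lemma spectralSubspace_eq_bot {L : X →ₗ[ℝ] X} {S : Set ℂ}
    (h : ∀ μ, IsComplexEigenvalue L μ → μ ∉ S) : spectralSubspace L S = ⊥ := by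
  have hbot : (⨆ μ ∈ S, Module.End.maxGenEigenspace
      (L.baseChange ℂ : Module.End ℂ (ℂ ⊗[ℝ] X)) μ) = ⊥ := by
    refine le_bot_iff.1 (iSup₂_le fun μ hμ => ?_)
    by_contra hne
    refine h μ ?_ hμ
    have : Module.End.HasUnifEigenvalue (L.baseChange ℂ : Module.End ℂ (ℂ ⊗[ℝ] X)) μ ⊤ := by
      intro h0
      exact hne h0.le
    exact this.lt zero_lt_one
  rw [eq_bot_iff]
  intro x hx
  have hx' : TensorProduct.mk ℝ ℂ X 1 x ∈ (⨆ μ ∈ S, Module.End.maxGenEigenspace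
      (L.baseChange ℂ : Module.End ℂ (ℂ ⊗[ℝ] X)) μ) := hx
  rw [hbot, Submodule.mem_bot] at hx'
  exact Module.FaithfullyFlat.tensorProduct_mk_injective X (hx'.trans (map_zero _).symm)

lemma spectralSubspace_eq_top [FiniteDimensional ℝ X] {L : X →ₗ[ℝ] X} {S : Set ℂ}
    (h : ∀ μ, IsComplexEigenvalue L μ → μ ∈ S) : spectralSubspace L S = ⊤ := by
  have htop : (⨆ μ ∈ S, Module.End.maxGenEigenspace
      (L.baseChange ℂ : Module.End ℂ (ℂ ⊗[ℝ] X)) μ) = ⊤ := by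
    rw [eq_top_iff, ← Module.End.iSup_maxGenEigenspace_eq_top (L.baseChange ℂ)]
    refine iSup_le fun μ => ?_
    by_cases hμ : μ ∈ S
    · exact le_iSup₂ (f := fun μ (_ : μ ∈ S) => Module.End.maxGenEigenspace
        (L.baseChange ℂ : Module.End ℂ (ℂ ⊗[ℝ] X)) μ) μ hμ
    · by_contra hne
      refine hμ (h μ ?_)
      have : Module.End.HasUnifEigenvalue (L.baseChange ℂ : Module.End ℂ (ℂ ⊗[ℝ] X)) μ ⊤ := by
        intro h0
        exact hne (h0.le.trans bot_le)
      exact this.lt zero_lt_one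
  rw [spectralSubspace, htop]
  rfl

lemma mem_spectralSubspace_of_apply_eq_zero {L : X →ₗ[ℝ] X} {S : Set ℂ} (h0 : (0 : ℂ) ∈ S) {x : X}
    (hx : L x = 0) : x ∈ spectralSubspace L S := by
  have hle := le_iSup₂ (f := fun μ (_ : μ ∈ S) => Module.End.maxGenEigenspace
        (L.baseChange ℂ : Module.End ℂ (ℂ ⊗[ℝ] X)) μ) 0 h0
  refine hle ?_
  simp only [Module.End.mem_maxGenEigenspace]
  exact ⟨1, by simp [hx]⟩

lemma isComplexEigenvalue_zero_of_apply_eq_zero {L : X →ₗ[ℝ] X} {x : X} (hx : L x = 0)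
    (hx0 : x ≠ 0) : IsComplexEigenvalue L 0 := by
  refine Module.End.hasEigenvalue_of_hasEigenvector (x := (1 : ℂ) ⊗ₜ[ℝ] x) ⟨?_, ?_⟩
  · rw [Module.End.mem_eigenspace_iff]
    simp [hx]
  · intro h
    exact hx0 (Module.FaithfullyFlat.tensorProduct_mk_injective (A := ℝ) (B := ℂ) X
      (h.trans (map_zero _).symm))

lemma eq_zero_of_isComplexEigenvalue_zero {μ : ℂ} (h : IsComplexEigenvalue (0 : X →ₗ[ℝ] X) μ) :
    μ = 0 := by
  obtain ⟨z, hz, hz0⟩ := Module.End.HasEigenvalue.exists_hasEigenvector h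
  rw [Module.End.mem_eigenspace_iff] at hz
  simp only [LinearMap.baseChange_zero, LinearMap.zero_apply] at hz
  exact (smul_eq_zero.1 hz.symm).resolve_right hz0

end SpectralSubspaces

section SkewProduct

variable {E : Type*} [AddCommGroup E] [Module ℝ E]

/-- If a block triangular operator on `E × ℝ` has an imaginary eigenvalue which its `E`-block does
not have, then the scalar diagonal block vanishes: it is real and an eigenvalue. -/
lemma snd_eq_zero_of_isComplexEigenvalue {A : E →ₗ[ℝ] E} {J : E × ℝ →ₗ[ℝ] E × ℝ}
    (hA : ∀ μ, IsComplexEigenvalue A μ → μ.re ≠ 0)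
    (hJA : ∀ w, J (w, 0) = (A w, 0)) {μ : ℂ} (hμ : IsComplexEigenvalue J μ) (hre : μ.re = 0)
    (p : E × ℝ) : (J p).2 = 0 := by
  set c : ℝ := (J (0, 1)).2
  have hsnd : ∀ p, (J p).2 = c * p.2 := by
    intro p
    have : p = (p.1, 0) + p.2 • ((0 : E), (1 : ℝ)) := by ext <;> simp
    rw [this, map_add, map_smul, hJA]
    simp [c, mul_comm]
  by_cases hc : c = 0
  · simp [hsnd, hc]
  exfalso
  obtain ⟨z, hz, hz0⟩ := Module.End.HasEigenvalue.exists_hasEigenvector hμ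
  rw [Module.End.mem_eigenspace_iff] at hz
  have h1 : LinearMap.snd ℝ E ℝ ∘ₗ J = (c • LinearMap.id) ∘ₗ LinearMap.snd ℝ E ℝ := by
    ext p <;> simp [hsnd]
  have h2 := baseChange_apply_of_comp_eq h1 z
  rw [hz, map_smul] at h2
  have h3 : (LinearMap.snd ℝ E ℝ).baseChange ℂ z = 0 := by
    rw [LinearMap.baseChange_smul, LinearMap.baseChange_id] at h2
    have h4 : (μ - (c : ℂ)) • (LinearMap.snd ℝ E ℝ).baseChange ℂ z = 0 := by
      rw [sub_smul, h2]
      exact sub_self _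
    refine (smul_eq_zero.1 h4).resolve_left fun h => hc ?_
    have := congrArg Complex.re h
    simp [hre] at this
    exact this
  have h5 : (LinearMap.inl ℝ E ℝ).baseChange ℂ ((LinearMap.fst ℝ E ℝ).baseChange ℂ z) = z := by
    have h6 : (LinearMap.inl ℝ E ℝ) ∘ₗ (LinearMap.fst ℝ E ℝ) +
        (LinearMap.inr ℝ E ℝ) ∘ₗ (LinearMap.snd ℝ E ℝ) = LinearMap.id := by
      ext p <;> simp
    have h7 := congrArg (LinearMap.baseChange ℂ) h6
    rw [LinearMap.baseChange_add, LinearMap.baseChange_comp, LinearMap.baseChange_comp,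
      LinearMap.baseChange_id] at h7
    have h8 := LinearMap.congr_fun h7 z
    simpa [h3] using h8
  have h9 : J ∘ₗ LinearMap.inl ℝ E ℝ = LinearMap.inl ℝ E ℝ ∘ₗ A := by
    ext w <;> simp [hJA]
  have h10 := baseChange_apply_of_comp_eq h9.symm ((LinearMap.fst ℝ E ℝ).baseChange ℂ z)
  rw [h5, hz] at h10
  have h11 : LinearMap.fst ℝ E ℝ ∘ₗ LinearMap.inl ℝ E ℝ = LinearMap.id := by ext; simp
  have h12 := congrArg ((LinearMap.fst ℝ E ℝ).baseChange ℂ) h10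
  rw [← LinearMap.comp_apply, ← LinearMap.baseChange_comp, h11, LinearMap.baseChange_id,
    map_smul] at h12
  refine hA μ (Module.End.hasEigenvalue_of_hasEigenvector
    (x := (LinearMap.fst ℝ E ℝ).baseChange ℂ z) ⟨?_, ?_⟩) hre
  · rw [Module.End.mem_eigenspace_iff]
    exact h12
  · intro h
    rw [h, map_zero] at h5
    exact hz0 h5.symm

lemma surjective_of_isComplexEigenvalue_re_neg [FiniteDimensional ℝ E] {A : E →ₗ[ℝ] E}
    (hA : ∀ μ, IsComplexEigenvalue A μ → μ.re < 0) : Function.Surjective A := by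
  refine LinearMap.surjective_of_injective ((injective_iff_map_eq_zero A).2 fun x hx => ?_)
  by_contra hne
  simpa using hA 0 (isComplexEigenvalue_zero_of_apply_eq_zero hx hne)

variable {A : E →ₗ[ℝ] E} {J : E × ℝ →ₗ[ℝ] E × ℝ} {v : E}

lemma mem_centreSubspace_iff (hA : ∀ μ, IsComplexEigenvalue A μ → μ.re < 0)
    (hJ : ∀ p, J p = (A (p.1 - p.2 • v), 0)) {p : E × ℝ} :
    p ∈ centreSubspace J ↔ p.1 = p.2 • v := by
  constructor
  · intro hp
    have h1 : (LinearMap.fst ℝ E ℝ - (LinearMap.snd ℝ E ℝ).smulRight v) ∘ₗ J =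
        A ∘ₗ (LinearMap.fst ℝ E ℝ - (LinearMap.snd ℝ E ℝ).smulRight v) := by
      ext p <;> simp [hJ]
    have h2 := map_mem_spectralSubspace h1 hp
    rw [spectralSubspace_eq_bot (fun μ hμ => by simpa using (hA μ hμ).ne)] at h2
    exact sub_eq_zero.1 (by simpa using h2)
  · intro hp
    exact mem_spectralSubspace_of_apply_eq_zero (by simp) (by simp [hJ, hp])

lemma mem_stable_sup_unstable_iff [FiniteDimensional ℝ E]
    (hA : ∀ μ, IsComplexEigenvalue A μ → μ.re < 0)
    (hJ : ∀ p, J p = (A (p.1 - p.2 • v), 0)) {p : E × ℝ} :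
    p ∈ stableSubspace J ⊔ unstableSubspace J ↔ p.2 = 0 := by
  have h1 : LinearMap.snd ℝ E ℝ ∘ₗ J = 0 ∘ₗ LinearMap.snd ℝ E ℝ := by
    ext p <;> simp [hJ]
  constructor
  · have hle : stableSubspace J ⊔ unstableSubspace J ≤ LinearMap.ker (LinearMap.snd ℝ E ℝ) := by
      refine sup_le (fun q hq => ?_) (fun q hq => ?_)
      all_goals
        have h2 := map_mem_spectralSubspace h1 hq
        rw [spectralSubspace_eq_bot
          (fun μ hμ => by simp [eq_zero_of_isComplexEigenvalue_zero hμ])] at h2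
        simpa using h2
    intro hp
    simpa using hle hp
  · intro hp
    refine Submodule.mem_sup_left ?_
    have h2 : LinearMap.inl ℝ E ℝ ∘ₗ A = J ∘ₗ LinearMap.inl ℝ E ℝ := by
      ext w <;> simp [hJ]
    have h3 : p.1 ∈ spectralSubspace A {μ | μ.re < 0} := by
      rw [spectralSubspace_eq_top (S := {μ | μ.re < 0}) hA]; trivial
    have h4 := map_mem_spectralSubspace h2 h3
    have h5 : p = (LinearMap.inl ℝ E ℝ) p.1 := by ext <;> simp [hp]
    rw [h5]
    exact h4

end SkewProduct

/-! ### Lyapunov forms of stable operators -/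

section Lyapunov

open scoped ENNReal

/-- If the spectral radius of an element of a complex Banach algebra is less than `1`, its powers
tend to `0`. -/
lemma tendsto_pow_zero_of_spectralRadius_lt_one {R : Type*} [NormedRing R] [NormedAlgebra ℂ R]
    [CompleteSpace R] {a : R} (ha : spectralRadius ℂ a < 1) :
    Tendsto (fun k : ℕ => a ^ k) atTop (𝓝 0) := by
  obtain ⟨q, hq, hq1⟩ := exists_between ha
  have hq1' : q ≠ ⊤ := (hq1.trans ENNReal.one_lt_top).ne
  lift q to ℝ≥0 using hq1'
  have hq1'' : q < 1 := by exact_mod_cast hq1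
  have h1 := (spectrum.gelfand_formula a).eventually (gt_mem_nhds hq)
  rw [tendsto_zero_iff_norm_tendsto_zero]
  refine squeeze_zero' (g := fun k => (q : ℝ) ^ k) (Eventually.of_forall fun _ => norm_nonneg _) ?_
    (tendsto_pow_atTop_nhds_zero_of_lt_one q.2 (by exact_mod_cast hq1''))
  filter_upwards [h1, eventually_gt_atTop 0] with k hk hk0
  have h2 := ENNReal.rpow_le_rpow hk.le (z := (k : ℝ)) (by positivity)
  rw [← ENNReal.rpow_mul, one_div_mul_cancel (by positivity), ENNReal.rpow_one,
    ENNReal.rpow_natCast] at h2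
  exact_mod_cast h2

attribute [local instance] Matrix.linftyOpNormedRing Matrix.linftyOpNormedAlgebra

lemma tendsto_pow_zero_of_isComplexEigenvalue {E : Type*} [NormedAddCommGroup E] [NormedSpace ℝ E]
    [FiniteDimensional ℝ E] (T : E →L[ℝ] E)
    (hT : ∀ μ, IsComplexEigenvalue (T : E →ₗ[ℝ] E) μ → ‖μ‖ < 1) :
    Tendsto (fun k : ℕ => T ^ k) atTop (𝓝 0) := by
  let b := Module.finBasis ℝ E
  let bC := Algebra.TensorProduct.basis ℂ b
  let Φ : (E →L[ℝ] E) →ₗ[ℝ] Matrix (Fin (Module.finrank ℝ E)) (Fin (Module.finrank ℝ E)) ℂ :=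
    { toFun := fun S => LinearMap.toMatrixAlgEquiv bC ((S : E →ₗ[ℝ] E).baseChange ℂ)
      map_add' := fun S S' => by simp [LinearMap.baseChange_add]
      map_smul' := fun r S => by
        ext i j
        simp only [ContinuousLinearMap.toLinearMap_smul, LinearMap.baseChange_smul,
          LinearMap.toMatrixAlgEquiv_apply, LinearMap.smul_apply, RingHom.id_apply,
          Matrix.smul_apply]
        have h := congrArg (fun c => c i) (bC.repr.map_smul (r : ℂ)
          ((S : E →ₗ[ℝ] E).baseChange ℂ (bC j)))
        rw [Finsupp.smul_apply, smul_eq_mul] at h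
        exact h }
  have hΦpow : ∀ k : ℕ, Φ (T ^ k) = (Φ T) ^ k := by
    intro k
    simp only [Φ, LinearMap.coe_mk, AddHom.coe_mk]
    rw [ContinuousLinearMap.toLinearMap_pow, LinearMap.baseChange_pow, map_pow]
  have hinj : LinearMap.ker Φ = ⊥ := by
    rw [LinearMap.ker_eq_bot']
    intro S hS
    have h1 : (S : E →ₗ[ℝ] E).baseChange ℂ = 0 :=
      (LinearMap.toMatrixAlgEquiv bC).injective (hS.trans (map_zero _).symm)
    ext x
    have h2 := LinearMap.congr_fun h1 ((1 : ℂ) ⊗ₜ[ℝ] x)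
    simp only [LinearMap.baseChange_tmul, LinearMap.zero_apply] at h2
    exact Module.FaithfullyFlat.tensorProduct_mk_injective (A := ℝ) (B := ℂ) E
      (h2.trans (map_zero _).symm)
  have hemb := LinearMap.isClosedEmbedding_of_injective hinj
  rw [hemb.tendsto_nhds_iff, map_zero]
  simp only [Function.comp_def, hΦpow]
  refine tendsto_pow_zero_of_spectralRadius_lt_one ?_
  rcases (spectrum ℂ (Φ T)).eq_empty_or_nonempty with h | h
  · rw [spectralRadius, h]; simp
  · have := spectrum.spectralRadius_lt_of_forall_lt_of_nonempty h (r := 1) (fun z hz => by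
      have hz' : z ∈ spectrum ℂ ((T : E →ₗ[ℝ] E).baseChange ℂ : Module.End ℂ (ℂ ⊗[ℝ] E)) := by
        rw [← AlgEquiv.spectrum_eq (LinearMap.toMatrixAlgEquiv bC)]
        exact hz
      have := hT z (Module.End.hasEigenvalue_iff_mem_spectrum.2 hz')
      exact_mod_cast this)
    simpa using this

lemma exists_pos_norm_one_add_mul_lt_one {S : Set ℂ} (hS : S.Finite) (hneg : ∀ μ ∈ S, μ.re < 0) :
    ∃ h : ℝ, 0 < h ∧ ∀ μ ∈ S, ‖1 + (h : ℂ) * μ‖ < 1 := by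
  have h1 : ∀ μ ∈ S, ∀ᶠ h : ℝ in 𝓝[>] 0, ‖1 + (h : ℂ) * μ‖ < 1 := by
    intro μ hμ
    have hμ' := hneg μ hμ
    have hcont : Tendsto (fun h : ℝ => 2 * μ.re + h * (μ.re ^ 2 + μ.im ^ 2)) (𝓝[>] 0)
        (𝓝 (2 * μ.re + 0 * (μ.re ^ 2 + μ.im ^ 2))) :=
      ((by fun_prop : Continuous fun h : ℝ => 2 * μ.re + h * (μ.re ^ 2 + μ.im ^ 2)).tendsto
        0).mono_left nhdsWithin_le_nhds
    filter_upwards [hcont.eventually_lt_const (u := 0) (by linarith), self_mem_nhdsWithin]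
      with h hh hpos
    have hpos' : (0 : ℝ) < h := hpos
    rw [← sq_lt_one_iff₀ (norm_nonneg _), Complex.sq_norm, Complex.normSq_apply]
    simp
    nlinarith
  obtain ⟨h, h2, h3⟩ := ((eventually_all_finite hS).2 h1 |>.and self_mem_nhdsWithin).exists
  exact ⟨h, h3, h2⟩

/-- Lyapunov's theorem: an operator whose eigenvalues have negative real part is strictly
dissipative for some inner product. The inner product is a sum `∑ ⟪T ^ k x, T ^ k y⟫` over the
powers of an Euler step `T = 1 + h A`, which are eventually contracting. -/
lemma exists_lyapunov_form {E : Type*} [NormedAddCommGroup E] [InnerProductSpace ℝ E]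
    [FiniteDimensional ℝ E] (A : E →ₗ[ℝ] E) (hA : ∀ μ, IsComplexEigenvalue A μ → μ.re < 0) :
    ∃ (B : E →L[ℝ] E →L[ℝ] ℝ) (a : ℝ), 0 < a ∧ (∀ x y, B x y = B y x) ∧
      (∀ x, ‖x‖ ^ 2 ≤ B x x) ∧ ∀ x, B x (A x) ≤ -a * ‖x‖ ^ 2 := by
  obtain ⟨h, hpos, hh⟩ := exists_pos_norm_one_add_mul_lt_one
    (Module.End.finite_hasEigenvalue (A.baseChange ℂ : Module.End ℂ (ℂ ⊗[ℝ] E))) hA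
  let T : E →L[ℝ] E := 1 + h • LinearMap.toContinuousLinearMap A
  have hTx : ∀ x, T x = x + h • A x := fun x => by simp [T]
  have hTC : ∀ z, (T : E →ₗ[ℝ] E).baseChange ℂ z = z + (h : ℂ) • A.baseChange ℂ z := by
    intro z
    have : (T : E →ₗ[ℝ] E) = LinearMap.id + h • A := by ext x; simp [hTx]
    rw [this, LinearMap.baseChange_add, LinearMap.baseChange_smul, LinearMap.baseChange_id]
    rfl
  have hT : ∀ μ, IsComplexEigenvalue (T : E →ₗ[ℝ] E) μ → ‖μ‖ < 1 := by
    intro μ hμ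
    obtain ⟨z, hz, hz0⟩ := Module.End.HasEigenvalue.exists_hasEigenvector hμ
    rw [Module.End.mem_eigenspace_iff, hTC] at hz
    have hh0 : (h : ℂ) ≠ 0 := by exact_mod_cast hpos.ne'
    have : IsComplexEigenvalue A ((μ - 1) / h) := by
      refine Module.End.hasEigenvalue_of_hasEigenvector (x := z) ⟨?_, hz0⟩
      rw [Module.End.mem_eigenspace_iff, div_eq_inv_mul, mul_smul, sub_smul, one_smul, ← hz,
        add_sub_cancel_left, smul_smul, inv_mul_cancel₀ hh0, one_smul]
    have h2 := hh _ this
    rwa [mul_div_cancel₀ _ hh0, add_sub_cancel] at h2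
  have hlim := (tendsto_pow_zero_of_isComplexEigenvalue T hT).norm
  rw [norm_zero] at hlim
  obtain ⟨m, hm, hm1⟩ := ((hlim.eventually (gt_mem_nhds one_pos)).and
    (eventually_ge_atTop 1)).exists
  have hm2 : ‖T ^ m‖ ^ 2 < 1 := by rwa [sq_lt_one_iff₀ (norm_nonneg _)]
  let B : E →L[ℝ] E →L[ℝ] ℝ :=
    ∑ k ∈ Finset.range m, (innerSL ℝ).bilinearComp (T ^ k) (T ^ k)
  have hB : ∀ x y, B x y = ∑ k ∈ Finset.range m, inner ℝ ((T ^ k) x) ((T ^ k) y) := by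
    intro x y
    simp [B]
  have hsymm : ∀ x y, B x y = B y x := by
    intro x y
    rw [hB, hB]
    exact Finset.sum_congr rfl fun k _ => real_inner_comm _ _
  have hBx : ∀ x, B x x = ∑ k ∈ Finset.range m, ‖(T ^ k) x‖ ^ 2 := by
    intro x
    rw [hB]
    exact Finset.sum_congr rfl fun k _ => real_inner_self_eq_norm_sq _
  refine ⟨B, (1 - ‖T ^ m‖ ^ 2) / (2 * h), by apply div_pos <;> linarith, hsymm, ?_, ?_⟩
  · intro x
    rw [hBx]
    have := Finset.single_le_sum (f := fun k => ‖(T ^ k) x‖ ^ 2) (fun k _ => by positivity)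
      (Finset.mem_range.2 hm1)
    simpa using this
  · intro x
    have h1 : B (T x) (T x) = B x x - ‖x‖ ^ 2 + ‖(T ^ m) x‖ ^ 2 := by
      have h2 : B (T x) (T x) = ∑ k ∈ Finset.range m, ‖(T ^ (k + 1)) x‖ ^ 2 := by
        rw [hBx]
        exact Finset.sum_congr rfl fun k _ => by rw [pow_succ T, mul_apply_eq_comp]
      have h3 := Finset.sum_range_succ (fun k => ‖(T ^ k) x‖ ^ 2) m
      have h4 := Finset.sum_range_succ' (fun k => ‖(T ^ k) x‖ ^ 2) m
      simp only [pow_zero, one_apply_eq_self] at h4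
      rw [h2, hBx]
      linarith
    have h2 : B (T x) (T x) = B x x + 2 * h * B x (A x) + h ^ 2 * B (A x) (A x) := by
      rw [hTx]
      simp only [map_add, map_smul, add_apply, smul_apply,
        smul_eq_mul, hsymm (A x) x]
      ring
    have h3 : 0 ≤ B (A x) (A x) := by
      rw [hBx]; positivity
    have h4 : ‖(T ^ m) x‖ ^ 2 ≤ ‖T ^ m‖ ^ 2 * ‖x‖ ^ 2 := by
      rw [← mul_pow]
      exact pow_le_pow_left₀ (norm_nonneg _) ((T ^ m).le_opNorm x) 2
    have h5 : 0 ≤ h ^ 2 * B (A x) (A x) := by positivity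
    have h6 : B x (A x) * (2 * h) ≤ -(1 - ‖T ^ m‖ ^ 2) * ‖x‖ ^ 2 := by linarith
    rw [← le_div_iff₀ (by positivity)] at h6
    refine h6.trans (le_of_eq ?_)
    ring

end Lyapunov

/-! ### Dissipativity and the cone condition -/

section Cones

lemma IsSolutionOn.mono {X : Type*} [NormedAddCommGroup X] [NormedSpace ℝ X] {F : X → X} {P : Set X}
    {φ : ℝ → X} {I I' : Set ℝ} (h : IsSolutionOn F P φ I) (hI : I' ⊆ I) : IsSolutionOn F P φ I' :=
  fun t ht => ⟨(h t (hI ht)).1, (h t (hI ht)).2.mono hI⟩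

variable {E : Type*} [NormedAddCommGroup E] [NormedSpace ℝ E]

/-- The linear projection of `E × ℝ` onto `E` along `(v, 1)`. -/
noncomputable def tilt (v : E) : E × ℝ →L[ℝ] E :=
  ContinuousLinearMap.fst ℝ E ℝ - (ContinuousLinearMap.snd ℝ E ℝ).smulRight v

@[simp] lemma tilt_apply (v : E) (p : E × ℝ) : tilt v p = p.1 - p.2 • v := by simp [tilt]

/-- The quadratic form of `B`, evaluated on the component of `p` in `E` along `(v, 1)`. -/
noncomputable def tiltForm (B : E →L[ℝ] E →L[ℝ] ℝ) (v : E) (p : E × ℝ) : ℝ := B (tilt v p) (tilt v p)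

/-- Differences of solutions of `y' = F y` in `D` contract in the direction of `E`, measured by the
form `B`, at rate `κ / 2`, and move along the axis `(v, 1)` at a rate of at most `ε`. -/
structure IsDissipativeOn (F : E × ℝ → E × ℝ) (D : Set (E × ℝ)) (B : E →L[ℝ] E →L[ℝ] ℝ) (v : E)
    (κ ε : ℝ) : Prop where
  transverse : ∀ p ∈ D, ∀ q ∈ D,
    2 * B (tilt v (p - q)) (tilt v (F p - F q)) ≤ -κ * tiltForm B v (p - q) + ε * (p - q).2 ^ 2
  axial : ∀ p ∈ D, ∀ q ∈ D, |(F p - F q).2| ≤ ε * |(p - q).2|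

/-- The cylinder of radius and height `R` over the base point `(η, -1)`. -/
def cylinder (η : E) (R : ℝ) : Set (E × ℝ) := Metric.closedBall η R ×ˢ Icc (-1) (-1 + R)

lemma IsDissipativeOn.mono {F : E × ℝ → E × ℝ} {D D' : Set (E × ℝ)} {B : E →L[ℝ] E →L[ℝ] ℝ} {v : E}
    {κ ε : ℝ} (h : IsDissipativeOn F D B v κ ε) (hD : D' ⊆ D) : IsDissipativeOn F D' B v κ ε :=
  ⟨fun p hp q hq => h.1 p (hD hp) q (hD hq), fun p hp q hq => h.2 p (hD hp) q (hD hq)⟩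

lemma tiltForm_le (B : E →L[ℝ] E →L[ℝ] ℝ) (v : E) (p : E × ℝ) :
    tiltForm B v p ≤ ‖B‖ * ‖tilt v‖ ^ 2 * ‖p‖ ^ 2 := by
  have h1 : tiltForm B v p ≤ ‖B‖ * ‖tilt v p‖ * ‖tilt v p‖ :=
    (le_abs_self _).trans (B.le_opNorm₂ _ _)
  have h2 := (tilt v).le_opNorm p
  have h3 : ‖tilt v p‖ * ‖tilt v p‖ ≤ (‖tilt v‖ * ‖p‖) * (‖tilt v‖ * ‖p‖) := by gcongr
  nlinarith [norm_nonneg B]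

lemma continuous_tiltForm (B : E →L[ℝ] E →L[ℝ] ℝ) (v : E) : Continuous (tiltForm B v) := by
  unfold tiltForm
  fun_prop

/-- A field with a linearization that is dissipative along `E` and vanishes along `(v, 1)` is
dissipative wherever its nonlinear part has a small Lipschitz constant `δ`. -/
lemma isDissipativeOn_of_norm_sub_le {F : E × ℝ → E × ℝ} {D : Set (E × ℝ)}
    {B : E →L[ℝ] E →L[ℝ] ℝ} {v : E} {A : E →ₗ[ℝ] E} {J : E × ℝ →ₗ[ℝ] E × ℝ} {a δ ε : ℝ}
    (ha : 0 < a) (hBA : ∀ x, B x (A x) ≤ -a * ‖x‖ ^ 2)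
    (hJ : ∀ p, J p = (A (p.1 - p.2 • v), 0)) (hδ : 0 ≤ δ)
    (hδa : 3 * ‖B‖ * (1 + ‖v‖) ^ 2 * δ ≤ a) (hδε : ‖B‖ * (1 + ‖v‖) ^ 2 * δ ≤ ε) (hδε' : δ ≤ ε)
    (hF : ∀ p ∈ D, ∀ q ∈ D, ‖F p - F q - J (p - q)‖ ≤ δ * ‖p - q‖)
    (hF2 : ∀ p ∈ D, ∀ q ∈ D, |(F p - F q).2| ≤ δ * |(p - q).2|) :
    IsDissipativeOn F D B v (a / (‖B‖ + 1)) ε := by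
  refine ⟨fun p hp q hq => ?_, fun p hp q hq => (hF2 p hp q hq).trans (by gcongr)⟩
  set L := 1 + ‖v‖ with hL
  have hL1 : 1 ≤ L := by simp [hL]
  set u := tilt v (p - q) with hu
  set τ := (p - q).2 with hτ
  set e := F p - F q - J (p - q) with he
  have hpq : ‖p - q‖ ≤ ‖u‖ + L * |τ| := by
    have h1 : (p - q).1 = u + τ • v := by simp [hu, hτ]
    rw [Prod.norm_def, h1]
    refine max_le ((norm_add_le _ _).trans ?_) ?_
    · rw [norm_smul, Real.norm_eq_abs]
      nlinarith [abs_nonneg τ]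
    · rw [Real.norm_eq_abs]
      nlinarith [abs_nonneg τ, norm_nonneg u]
  have h1 : tilt v (F p - F q) = A u + tilt v e := by
    have h2 : F p - F q = J (p - q) + e := by simp [he]
    rw [h2, map_add, hJ]
    simp [hu]
  have h2 : ‖tilt v e‖ ≤ L * (δ * (‖u‖ + L * |τ|)) := by
    have h3 : ‖e‖ ≤ δ * (‖u‖ + L * |τ|) := (hF p hp q hq).trans (by gcongr)
    have h4 : ‖e.1‖ ≤ ‖e‖ := norm_fst_le e
    have h5 : |e.2| ≤ ‖e‖ := norm_snd_le e
    calc ‖tilt v e‖ ≤ ‖e.1‖ + ‖e.2 • v‖ := by rw [tilt_apply]; exact norm_sub_le _ _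
      _ ≤ ‖e‖ + ‖e‖ * ‖v‖ := by rw [norm_smul, Real.norm_eq_abs]; gcongr
      _ = L * ‖e‖ := by rw [hL]; ring
      _ ≤ _ := by gcongr
  have h3 : B u (tilt v e) ≤ ‖B‖ * ‖u‖ * (L * (δ * (‖u‖ + L * |τ|))) :=
    (le_abs_self _).trans ((B.le_opNorm₂ _ _).trans (by gcongr))
  have h4 : tiltForm B v (p - q) ≤ ‖B‖ * ‖u‖ ^ 2 := by
    refine (le_abs_self _).trans ((B.le_opNorm₂ _ _).trans (le_of_eq ?_))
    ring
  have hM := norm_nonneg B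
  have h5 : a / (‖B‖ + 1) * tiltForm B v (p - q) ≤ a * ‖u‖ ^ 2 := by
    calc a / (‖B‖ + 1) * tiltForm B v (p - q) ≤ a / (‖B‖ + 1) * (‖B‖ * ‖u‖ ^ 2) := by gcongr
      _ ≤ a / (‖B‖ + 1) * ((‖B‖ + 1) * ‖u‖ ^ 2) := by gcongr; linarith
      _ = a * ‖u‖ ^ 2 := by field_simp
  have h6 : 2 * (‖B‖ * ‖u‖ * (L * (δ * (‖u‖ + L * |τ|)))) ≤
      3 * ‖B‖ * L ^ 2 * δ * ‖u‖ ^ 2 + ‖B‖ * L ^ 2 * δ * τ ^ 2 := by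
    have h7 : 2 * (‖u‖ * |τ|) ≤ ‖u‖ ^ 2 + τ ^ 2 := by
      rw [← sq_abs τ]; nlinarith [sq_nonneg (‖u‖ - |τ|)]
    have h8 : 0 ≤ ‖B‖ * δ := by positivity
    have h9 : L * ‖u‖ ^ 2 ≤ L ^ 2 * ‖u‖ ^ 2 := by
      have : L ≤ L ^ 2 := by nlinarith
      gcongr
    have h10 : 2 * (‖u‖ * (L * (‖u‖ + L * |τ|))) ≤ 3 * L ^ 2 * ‖u‖ ^ 2 + L ^ 2 * τ ^ 2 := by
      have h11 : L ^ 2 * (2 * (‖u‖ * |τ|)) ≤ L ^ 2 * (‖u‖ ^ 2 + τ ^ 2) := by gcongr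
      nlinarith
    have := mul_le_mul_of_nonneg_left h10 h8
    nlinarith
  have h7 : 3 * ‖B‖ * L ^ 2 * δ * ‖u‖ ^ 2 ≤ a * ‖u‖ ^ 2 := by gcongr
  have h8 : ‖B‖ * L ^ 2 * δ * τ ^ 2 ≤ ε * τ ^ 2 := by gcongr
  have h9 := hBA u
  rw [h1, map_add]
  linarith

variable {F : E × ℝ → E × ℝ} {P D : Set (E × ℝ)} {B : E →L[ℝ] E →L[ℝ] ℝ} {v : E} {κ ε : ℝ}

lemma hasDerivWithinAt_tiltForm_sub (hsymm : ∀ x y, B x y = B y x) {φ ψ : ℝ → E × ℝ} {φ' ψ' : E × ℝ}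
    {s : Set ℝ} {t : ℝ} (hφ : HasDerivWithinAt φ φ' s t) (hψ : HasDerivWithinAt ψ ψ' s t) :
    HasDerivWithinAt (fun t => tiltForm B v (φ t - ψ t))
      (2 * B (tilt v (φ t - ψ t)) (tilt v (φ' - ψ'))) s t := by
  have h1 : HasDerivWithinAt (fun t => tilt v (φ t - ψ t)) (tilt v (φ' - ψ')) s t :=
    ((tilt v).hasFDerivAt.comp_hasDerivWithinAt t (hφ.sub hψ))
  have h2 : HasDerivWithinAt (fun t => B (tilt v (φ t - ψ t))) (B (tilt v (φ' - ψ'))) s t :=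
    B.hasFDerivAt.comp_hasDerivWithinAt t h1
  have h3 := h2.clm_apply h1
  refine h3.congr_deriv ?_
  rw [hsymm (tilt v (φ' - ψ'))]
  ring

/-- The cone condition: along the difference of two solutions, the quadratic form that vanishes
on the boundary of a cone around the axis `(v, 1)` decays exponentially. -/
lemma IsDissipativeOn.tiltForm_sub_le (hd : IsDissipativeOn F D B v κ ε)
    (hsymm : ∀ x y, B x y = B y x) (hκ : 0 < κ) (hε : 0 ≤ ε) (hεκ : 4 * ε ≤ κ)
    {φ ψ : ℝ → E × ℝ} {t₁ t₂ : ℝ} (h12 : t₁ ≤ t₂)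
    (hφ : IsSolutionOn F P φ (Icc t₁ t₂)) (hψ : IsSolutionOn F P ψ (Icc t₁ t₂))
    (hφD : ∀ t ∈ Icc t₁ t₂, φ t ∈ D) (hψD : ∀ t ∈ Icc t₁ t₂, ψ t ∈ D) :
    tiltForm B v (φ t₂ - ψ t₂) - 2 * ε / κ * (φ t₂ - ψ t₂).2 ^ 2 ≤
      Real.exp (-κ * (t₂ - t₁)) *
        (tiltForm B v (φ t₁ - ψ t₁) - 2 * ε / κ * (φ t₁ - ψ t₁).2 ^ 2) := by
  -- With this slope and `4 ε ≤ κ`, the growth of `K τ²` absorbs the term `ε τ²` in the derivative.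
  set K := 2 * ε / κ with hK
  set W : ℝ → ℝ := fun t => tiltForm B v (φ t - ψ t) - K * (φ t - ψ t).2 ^ 2 with hW
  set W' : ℝ → ℝ := fun t => 2 * B (tilt v (φ t - ψ t)) (tilt v (F (φ t) - F (ψ t))) -
    K * (2 * (φ t - ψ t).2 * (F (φ t) - F (ψ t)).2) with hW'
  have hWd : ∀ t ∈ Icc t₁ t₂, HasDerivWithinAt W (W' t) (Icc t₁ t₂) t := by
    intro t ht
    refine (hasDerivWithinAt_tiltForm_sub hsymm (hφ t ht).2 (hψ t ht).2).sub ?_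
    have h1 : HasDerivWithinAt (fun t => (φ t - ψ t).2) (F (φ t) - F (ψ t)).2 (Icc t₁ t₂) t :=
      (ContinuousLinearMap.snd ℝ E ℝ).hasFDerivAt.comp_hasDerivWithinAt t
        ((hφ t ht).2.sub (hψ t ht).2)
    simpa using (h1.pow 2).const_mul K
  have hWle : ∀ t ∈ Icc t₁ t₂, κ * W t + W' t ≤ 0 := by
    intro t ht
    have h1 := hd.transverse _ (hφD t ht) _ (hψD t ht)
    have h2 := hd.axial _ (hφD t ht) _ (hψD t ht)
    set τ := (φ t - ψ t).2
    set τ' := (F (φ t) - F (ψ t)).2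
    have h3 : -(τ * τ') ≤ ε * τ ^ 2 := by
      calc -(τ * τ') ≤ |τ * τ'| := neg_le_abs _
        _ = |τ| * |τ'| := abs_mul _ _
        _ ≤ |τ| * (ε * |τ|) := by gcongr
        _ = ε * τ ^ 2 := by rw [← sq_abs τ]; ring
    have hK0 : 0 ≤ K := by positivity
    have h4 : K * -(τ * τ') ≤ K * (ε * τ ^ 2) := by gcongr
    have h5 : κ * K = 2 * ε := by rw [hK]; field_simp
    have h6 : 2 * K * ε ≤ ε := by
      have : 2 * K ≤ 1 := by
        rw [hK, ← mul_div_assoc, div_le_one hκ]; linarith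
      nlinarith
    have h7 : 2 * K * ε * τ ^ 2 ≤ ε * τ ^ 2 := by gcongr
    have h8 : κ * K * τ ^ 2 = 2 * ε * τ ^ 2 := by rw [h5]
    simp only [hW, hW']
    linarith
  have hanti : AntitoneOn (fun t => Real.exp (κ * t) * W t) (Icc t₁ t₂) := by
    have hder : ∀ t ∈ Icc t₁ t₂, HasDerivWithinAt (fun t => Real.exp (κ * t) * W t)
        (Real.exp (κ * t) * (κ * W t + W' t)) (Icc t₁ t₂) t := by
      intro t ht
      have h1 : HasDerivWithinAt (fun t => Real.exp (κ * t)) (Real.exp (κ * t) * κ)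
          (Icc t₁ t₂) t := by
        have := ((hasDerivAt_id t).const_mul κ).exp.hasDerivWithinAt (s := Icc t₁ t₂)
        simpa using this
      refine (h1.mul (hWd t ht)).congr_deriv ?_
      ring
    refine antitoneOn_of_deriv_nonpos (convex_Icc _ _) (fun t ht => (hder t ht).continuousWithinAt)
      (fun t ht => ((hder t (interior_subset ht)).differentiableWithinAt).mono interior_subset) ?_
    intro t ht
    rw [interior_Icc] at ht
    rw [((hder t (Ioo_subset_Icc_self ht)).hasDerivAt (Icc_mem_nhds ht.1 ht.2)).deriv]
    exact mul_nonpos_of_nonneg_of_nonpos (Real.exp_pos _).le (hWle t (Ioo_subset_Icc_self ht))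
  have h1 := hanti (left_mem_Icc.2 h12) (right_mem_Icc.2 h12) h12
  have h2 : Real.exp (-κ * (t₂ - t₁)) = Real.exp (κ * t₁) / Real.exp (κ * t₂) := by
    rw [← Real.exp_sub]; congr 1; ring
  change W t₂ ≤ _ * W t₁
  rw [h2, div_mul_eq_mul_div, le_div_iff₀ (Real.exp_pos _)]
  linarith

lemma tendsto_exp_neg_mul_atTop (hκ : 0 < κ) (t C : ℝ) :
    Tendsto (fun s : ℝ => Real.exp (-κ * (t - s)) * C) atBot (𝓝 0) := by
  have h1 : Tendsto (fun s : ℝ => -κ * (t - s)) atBot atBot := by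
    have : (fun s : ℝ => -κ * (t - s)) = fun s => κ * s + -κ * t := by ext s; ring
    rw [this]
    exact tendsto_atBot_add_const_right _ _ (tendsto_id.const_mul_atBot hκ)
  simpa using (Real.tendsto_exp_atBot.comp h1).mul_const C

/-- Two backward orbits that stay in a bounded dissipative set differ by a vector in the cone. -/
lemma IsDissipativeOn.tiltForm_le_of_backward (hd : IsDissipativeOn F D B v κ ε)
    (hsymm : ∀ x y, B x y = B y x) (hκ : 0 < κ) (hε : 0 ≤ ε) (hεκ : 4 * ε ≤ κ)
    {C : ℝ} (hC : ∀ p ∈ D, ∀ q ∈ D, tiltForm B v (p - q) ≤ C)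
    {φ ψ : ℝ → E × ℝ} (hφ : IsSolutionOn F P φ (Iic 0)) (hψ : IsSolutionOn F P ψ (Iic 0))
    (hφD : ∀ t ≤ 0, φ t ∈ D) (hψD : ∀ t ≤ 0, ψ t ∈ D) :
    tiltForm B v (φ 0 - ψ 0) ≤ 2 * ε / κ * (φ 0 - ψ 0).2 ^ 2 := by
  rw [← sub_nonpos]
  refine ge_of_tendsto (tendsto_exp_neg_mul_atTop hκ 0 C) ?_
  filter_upwards [eventually_le_atBot (0 : ℝ)] with s hs
  refine (hd.tiltForm_sub_le (P := P) hsymm hκ hε hεκ hs (hφ.mono Icc_subset_Iic_self)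
    (hψ.mono Icc_subset_Iic_self) (fun t ht => hφD t ht.2) (fun t ht => hψD t ht.2)).trans ?_
  gcongr
  have h1 := hC _ (hφD s hs) _ (hψD s hs)
  have h2 : 0 ≤ 2 * ε / κ * (φ s - ψ s).2 ^ 2 := by positivity
  linarith

end Cones

/-! ### Forward solutions in a tube -/

section Pullback

variable {E : Type*} [NormedAddCommGroup E]

/-- A piecewise linear cutoff: `1` on the ball of radius `R / 2` around `η`, and `0` outside the
ball of radius `R`. -/
noncomputable def cutoff (η : E) (R : ℝ) (x : E) : ℝ := max 0 (min 1 (2 - 2 / R * ‖x - η‖))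

lemma cutoff_nonneg (η : E) (R : ℝ) (x : E) : 0 ≤ cutoff η R x := le_max_left _ _

lemma cutoff_le_one (η : E) (R : ℝ) (x : E) : cutoff η R x ≤ 1 :=
  max_le zero_le_one (min_le_left _ _)

lemma cutoff_eq_one {η : E} {R : ℝ} (hR : 0 < R) {x : E} (hx : ‖x - η‖ ≤ R / 2) :
    cutoff η R x = 1 := by
  have h1 : 2 / R * ‖x - η‖ ≤ 1 := by
    calc 2 / R * ‖x - η‖ ≤ 2 / R * (R / 2) := by gcongr
      _ = 1 := by field_simp
  rw [cutoff, min_eq_left (by linarith), max_eq_right zero_le_one]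

lemma cutoff_eq_zero {η : E} {R : ℝ} (hR : 0 < R) {x : E} (hx : R < ‖x - η‖) :
    cutoff η R x = 0 := by
  have h1 : 2 ≤ 2 / R * ‖x - η‖ := by
    calc 2 = 2 / R * R := by field_simp
      _ ≤ _ := by gcongr
  rw [cutoff, max_eq_left]
  exact (min_le_right _ _).trans (by linarith)

lemma abs_cutoff_sub_le {η : E} {R : ℝ} (hR : 0 < R) (x y : E) :
    |cutoff η R x - cutoff η R y| ≤ 2 / R * ‖x - y‖ := by
  have h1 : |cutoff η R x - cutoff η R y| ≤
      |(2 - 2 / R * ‖x - η‖) - (2 - 2 / R * ‖y - η‖)| := by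
    unfold cutoff
    refine (abs_max_sub_max_le_max _ _ _ _).trans ?_
    rw [sub_self, abs_zero, max_eq_right (abs_nonneg _)]
    refine (abs_min_sub_min_le_max _ _ _ _).trans ?_
    rw [sub_self, abs_zero, max_eq_right (abs_nonneg _)]
  refine h1.trans ?_
  have h2 : (2 - 2 / R * ‖x - η‖) - (2 - 2 / R * ‖y - η‖) =
      2 / R * (‖y - η‖ - ‖x - η‖) := by ring
  rw [h2, abs_mul, abs_of_pos (by positivity : 0 < 2 / R)]
  gcongr
  refine (abs_norm_sub_norm_le _ _).trans (le_of_eq ?_)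
  rw [sub_sub_sub_cancel_right, norm_sub_rev]

variable [NormedSpace ℝ E]

lemma lipschitzWith_cutoff_smul {η : E} {R : ℝ} (hR : 0 < R) {G : E → E} {K C : ℝ≥0}
    (hG : LipschitzOnWith K G (Metric.closedBall η R))
    (hC : ∀ x ∈ Metric.closedBall η R, ‖G x‖ ≤ C) :
    LipschitzWith (K + ⟨2 / R, by positivity⟩ * C) (fun x => cutoff η R x • G x) := by
  have key : ∀ x ∈ Metric.closedBall η R, ∀ y,
      ‖cutoff η R x • G x - cutoff η R y • G y‖ ≤ (K + 2 / R * C) * ‖x - y‖ := by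
    intro x hx y
    have h1 : cutoff η R x • G x - cutoff η R y • G y =
        (cutoff η R x - cutoff η R y) • G x + cutoff η R y • (G x - G y) := by
      rw [sub_smul, smul_sub]; abel
    have h2 : ‖(cutoff η R x - cutoff η R y) • G x‖ ≤ 2 / R * ‖x - y‖ * C := by
      rw [norm_smul, Real.norm_eq_abs]
      gcongr
      · exact abs_cutoff_sub_le hR x y
      · exact hC x hx
    have h3 : ‖cutoff η R y • (G x - G y)‖ ≤ K * ‖x - y‖ := by
      by_cases hy : y ∈ Metric.closedBall η R
      · rw [norm_smul, Real.norm_eq_abs, abs_of_nonneg (cutoff_nonneg _ _ _)]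
        calc cutoff η R y * ‖G x - G y‖ ≤ 1 * (K * ‖x - y‖) := by
              gcongr
              · exact cutoff_le_one _ _ _
              · simpa [dist_eq_norm] using hG.dist_le_mul x hx y hy
          _ = _ := one_mul _
      · rw [cutoff_eq_zero hR (by simpa [dist_eq_norm] using hy), zero_smul, norm_zero]
        positivity
    rw [h1]
    refine (norm_add_le _ _).trans ?_
    linarith
  refine LipschitzWith.of_dist_le_mul fun x y => ?_
  rw [dist_eq_norm, dist_eq_norm]
  change _ ≤ ((K : ℝ) + 2 / R * C) * _
  by_cases hx : x ∈ Metric.closedBall η R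
  · exact key x hx y
  by_cases hy : y ∈ Metric.closedBall η R
  · rw [norm_sub_rev, norm_sub_rev x]
    exact key y hy x
  · rw [cutoff_eq_zero hR (by simpa [dist_eq_norm] using hx),
      cutoff_eq_zero hR (by simpa [dist_eq_norm] using hy)]
    simp only [zero_smul, sub_self, norm_zero]
    positivity

lemma exists_tiltForm_sub_le (B : E →L[ℝ] E →L[ℝ] ℝ) (v η : E) (R : ℝ) :
    ∃ C, ∀ p ∈ cylinder η R, ∀ q ∈ cylinder η R, tiltForm B v (p - q) ≤ C := by
  refine ⟨‖B‖ * ‖tilt v‖ ^ 2 * (2 * R) ^ 2, fun p hp q hq => (tiltForm_le B v _).trans ?_⟩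
  have h1 : ∀ p ∈ cylinder η R, ‖p - (η, -1)‖ ≤ R := by
    intro p hp
    refine max_le ?_ ?_
    · simpa [dist_eq_norm] using hp.1
    · have := hp.2
      simp only [Prod.snd_sub, Real.norm_eq_abs]
      rw [abs_le]
      constructor <;> linarith [this.1, this.2]
  have h2 : ‖p - q‖ ≤ 2 * R := by
    have h3 : p - q = (p - (η, -1)) - (q - (η, -1)) := by abel
    rw [h3]
    linarith [norm_sub_le (p - (η, -1)) (q - (η, -1)), h1 p hp, h1 q hq]
  gcongr

/-- The local situation at the equilibrium `(η, -1)` of a skew product `x' = (F (x, s)).1`,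
`s' = (F (x, s)).2` whose second component is solved by the strictly increasing function `g`, with
`g t → -1` in the past. In a cylinder of radius `R` the system is dissipative, and the final time
`T` is such that `g T` is close to `-1` compared with `R`.
The tube used below has radius `R / 4` and height `g T + 1`; it then lies over the ball of radius
`R / 2`, where the cutoff equals `1`. -/
structure IsDissipativeSkewProduct (F : E × ℝ → E × ℝ) (P : Set (E × ℝ)) (B : E →L[ℝ] E →L[ℝ] ℝ)
    (v η : E) (κ : ℝ) (g : ℝ → ℝ) (R T : ℝ) : Prop where
  symm : ∀ x y, B x y = B y x
  coercive : ∀ x, ‖x‖ ^ 2 ≤ B x x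
  κ_pos : 0 < κ
  R_pos : 0 < R
  dissipative : IsDissipativeOn F (cylinder η R) B v κ (κ / 4)
  lipschitz : ∃ K, LipschitzOnWith K F (cylinder η R)
  map_base : F (η, -1) = 0
  cylinder_subset : cylinder η R ⊆ P
  neg_one_le : ∀ p ∈ P, -1 ≤ p.2
  hasDerivAt : ∀ x t, HasDerivAt g (F (x, g t)).2 t
  neg_one_lt : ∀ t, -1 < g t
  strictMono : StrictMono g
  tendsto : Tendsto g atBot (𝓝 (-1))
  height_le : (g T + 1) * (1 + ‖v‖) ≤ R / 4

/-- The tube of radius `r`, measured by the form `B`, and height `δ` around the segment from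
`(η, -1)` in the direction `(v, 1)`. -/
def tube (B : E →L[ℝ] E →L[ℝ] ℝ) (v η : E) (r δ : ℝ) : Set (E × ℝ) :=
  {p | tiltForm B v (p - (η, -1)) < r ^ 2 ∧ |p.2 + 1| < δ}

lemma isOpen_tube (B : E →L[ℝ] E →L[ℝ] ℝ) (v η : E) (r δ : ℝ) : IsOpen (tube B v η r δ) := by
  have h := continuous_tiltForm B v
  exact (isOpen_lt (h.comp (continuous_id.sub continuous_const)) continuous_const).inter
    (isOpen_lt (by fun_prop : Continuous fun p : E × ℝ => |p.2 + 1|) continuous_const)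

namespace IsDissipativeSkewProduct

variable {F : E × ℝ → E × ℝ} {P : Set (E × ℝ)} {B : E →L[ℝ] E →L[ℝ] ℝ} {v η : E} {κ : ℝ}
  {g : ℝ → ℝ} {R T : ℝ}

lemma norm_tilt_sq_le (h : IsDissipativeSkewProduct F P B v η κ g R T) (p : E × ℝ) :
    ‖tilt v p‖ ^ 2 ≤ tiltForm B v p := h.coercive _

lemma height_pos (h : IsDissipativeSkewProduct F P B v η κ g R T) : 0 < g T + 1 := by
  linarith [h.neg_one_lt T]

lemma height_le' (h : IsDissipativeSkewProduct F P B v η κ g R T) : g T + 1 ≤ R / 4 := by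
  have := h.height_le
  nlinarith [h.height_pos, norm_nonneg v]

lemma norm_fst_sub_le (h : IsDissipativeSkewProduct F P B v η κ g R T) {p : E × ℝ}
    (hp : tiltForm B v (p - (η, -1)) < (R / 4) ^ 2) (hp2 : |p.2 + 1| ≤ g T + 1) :
    ‖p.1 - η‖ ≤ R / 2 := by
  have h1 : ‖tilt v (p - (η, -1))‖ ≤ R / 4 := by
    refine abs_le_of_sq_le_sq' ((h.norm_tilt_sq_le _).trans hp.le) (by linarith [h.R_pos]) |>.2
  have h2 : p.1 - η = tilt v (p - (η, -1)) + (p.2 + 1) • v := by simp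
  have h3 : ‖(p.2 + 1) • v‖ ≤ (g T + 1) * ‖v‖ := by
    rw [norm_smul, Real.norm_eq_abs]
    gcongr
  rw [h2]
  have := h.height_le
  nlinarith [norm_add_le (tilt v (p - (η, -1))) ((p.2 + 1) • v), h.height_pos]

lemma norm_sub_le_of_mem_tube (h : IsDissipativeSkewProduct F P B v η κ g R T) {p : E × ℝ}
    (hp : p ∈ tube B v η (R / 4) (g T + 1)) : ‖p - (η, -1)‖ ≤ R / 2 := by
  refine max_le (h.norm_fst_sub_le hp.1 hp.2.le) ?_
  rw [Prod.snd_sub, sub_neg_eq_add, Real.norm_eq_abs]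
  linarith [hp.2, h.height_le', h.R_pos]

lemma mem_cylinder (h : IsDissipativeSkewProduct F P B v η κ g R T) {p : E × ℝ}
    (hp : tiltForm B v (p - (η, -1)) < (R / 4) ^ 2) (hp1 : -1 ≤ p.2) (hp2 : p.2 ≤ g T) :
    p ∈ cylinder η R := by
  refine ⟨?_, hp1, ?_⟩
  · rw [mem_closedBall_iff_norm]
    have : |p.2 + 1| ≤ g T + 1 := by
      rw [abs_of_nonneg (by linarith)]
      linarith
    linarith [h.norm_fst_sub_le hp this, h.R_pos]
  · linarith [h.height_le', h.R_pos]

lemma mem_cylinder_of_mem_tube (h : IsDissipativeSkewProduct F P B v η κ g R T) {p : E × ℝ}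
    (hp : p ∈ tube B v η (R / 4) (g T + 1)) (hpP : p ∈ P) : p ∈ cylinder η R := by
  refine h.mem_cylinder hp.1 (h.neg_one_le p hpP) ?_
  linarith [(abs_lt.1 hp.2).2]

lemma base_mem_cylinder (h : IsDissipativeSkewProduct F P B v η κ g R T) :
    ((η, -1) : E × ℝ) ∈ cylinder η R :=
  ⟨Metric.mem_closedBall_self h.R_pos.le, le_rfl, by linarith [h.R_pos]⟩

lemma isSolutionOn_base (h : IsDissipativeSkewProduct F P B v η κ g R T) (I : Set ℝ) :
    IsSolutionOn F P (fun _ => (η, -1)) I := fun t _ =>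
  ⟨h.cylinder_subset h.base_mem_cylinder, by
    rw [h.map_base]; exact hasDerivWithinAt_const _ _ _⟩

variable [CompleteSpace E]

/-- Forward orbits that start in the tube stay inside its lateral boundary up to time `T`. -/
lemma exists_forward_solution (h : IsDissipativeSkewProduct F P B v η κ g R T) {t₁ : ℝ}
    (ht₁ : t₁ ≤ T) {p : E × ℝ} (hp2 : p.2 = g t₁)
    (hp : tiltForm B v (p - (η, -1)) < (R / 4) ^ 2) :
    ∃ φ : ℝ → E × ℝ, φ t₁ = p ∧ IsSolutionOn F P φ (Icc t₁ T) ∧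
      ∀ t ∈ Icc t₁ T, (φ t).2 = g t ∧ tiltForm B v (φ t - (η, -1)) < (R / 4) ^ 2 := by
  obtain ⟨K, hK⟩ := h.lipschitz
  have hR := h.R_pos
  have hgmem : ∀ t ∈ Icc t₁ T, g t ∈ Icc (-1) (-1 + R) := fun t ht =>
    ⟨(h.neg_one_lt t).le, by linarith [h.strictMono.monotone ht.2, h.height_le']⟩
  have hgT : ∀ t ∈ Icc t₁ T, g t ≤ g T := fun t ht => h.strictMono.monotone ht.2
  have hgcont : Continuous g := continuous_iff_continuousAt.2 fun t => (h.hasDerivAt η t).continuousAt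
  -- The field is bounded on the cylinder, so that its cutoff has solutions up to time `T`.
  obtain ⟨C, hC⟩ : ∃ C : ℝ≥0, ∀ p ∈ cylinder η R, ‖F p‖ ≤ C := by
    refine ⟨K * ⟨R, hR.le⟩, fun p hp => ?_⟩
    have h1 := hK.dist_le_mul p hp _ h.base_mem_cylinder
    rw [h.map_base, dist_zero_right] at h1
    refine h1.trans (mul_le_mul_of_nonneg_left ?_ K.2)
    change dist p (η, -1) ≤ R
    rw [Prod.dist_eq]
    refine max_le hp.1 ?_
    rw [Real.dist_eq, abs_le]
    constructor <;> linarith [hp.2.1, hp.2.2]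
  let f : ℝ → E → E := fun t x => cutoff η R x • (F (x, g t)).1
  have hf : IsPicardLindelof f (tmin := t₁) (tmax := T) ⟨t₁, left_mem_Icc.2 ht₁⟩ p.1
      (C * ⟨T - t₁, by linarith⟩) 0 C (K + ⟨2 / R, by positivity⟩ * C) := by
    refine ⟨fun t ht => ?_, fun x _ => ?_, fun t ht x _ => ?_, ?_⟩
    · refine (lipschitzWith_cutoff_smul hR (LipschitzOnWith.of_dist_le_mul fun x hx y hy => ?_)
        fun x hx => ?_).lipschitzOnWith
      · refine (le_max_left _ _).trans ((hK.dist_le_mul (x, g t) ⟨hx, hgmem t ht⟩ (y, g t)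
          ⟨hy, hgmem t ht⟩).trans (le_of_eq ?_))
        simp [Prod.dist_eq]
      · exact (norm_fst_le _).trans (hC _ ⟨hx, hgmem t ht⟩)
    · by_cases hx : x ∈ Metric.closedBall η R
      · have h1 : ContinuousOn (fun t => F (x, g t)) (Icc t₁ T) :=
          hK.continuousOn.comp (by fun_prop) fun t ht => ⟨hx, hgmem t ht⟩
        exact (continuous_fst.comp_continuousOn h1).const_smul _
      · have : cutoff η R x = 0 := cutoff_eq_zero hR (by simpa [dist_eq_norm] using hx)
        simp only [f, this, zero_smul]
        exact continuousOn_const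
    · by_cases hx : x ∈ Metric.closedBall η R
      · rw [norm_smul, Real.norm_eq_abs, abs_of_nonneg (cutoff_nonneg _ _ _)]
        calc cutoff η R x * ‖(F (x, g t)).1‖ ≤ 1 * C := by
              gcongr
              · exact cutoff_le_one _ _ _
              · exact (norm_fst_le _).trans (hC _ ⟨hx, hgmem t ht⟩)
          _ = C := one_mul _
      · simp only [f, cutoff_eq_zero hR (by simpa [dist_eq_norm] using hx), zero_smul, norm_zero]
        positivity
    · simp only [sub_self, NNReal.coe_zero, sub_zero]
      rw [max_eq_left (by linarith)]
      exact le_rfl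
  obtain ⟨α, hα1, hα⟩ := hf.exists_eq_forall_mem_Icc_hasDerivWithinAt₀
  let φ : ℝ → E × ℝ := fun t => (α t, g t)
  have hφ : ∀ t ∈ Icc t₁ T,
      HasDerivWithinAt φ (f t (α t), (F (φ t)).2) (Icc t₁ T) t := fun t ht =>
    (hα t ht).prodMk (h.hasDerivAt _ t).hasDerivWithinAt
  have hFφ : ∀ t ∈ Icc t₁ T, tiltForm B v (φ t - (η, -1)) < (R / 4) ^ 2 →
      (f t (α t), (F (φ t)).2) = F (φ t) := by
    intro t ht hlt
    have h1 := h.norm_fst_sub_le hlt (by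
      change |g t + 1| ≤ _
      rw [abs_of_pos (by linarith [h.neg_one_lt t])]
      linarith [hgT t ht])
    ext
    · change cutoff η R (α t) • (F (φ t)).1 = _
      rw [cutoff_eq_one hR h1, one_smul]
    · rfl
  have hφ1 : φ t₁ = p := by
    ext
    · exact hα1
    · exact hp2.symm
  -- On a slightly smaller lateral boundary the form decreases, so it is never crossed.
  have hδ : (g T + 1) ^ 2 ≤ (R / 4) ^ 2 := by
    have := h.height_le'
    have := h.height_pos
    gcongr
  obtain ⟨ρ, hρ, hρR⟩ : ∃ ρ, max (tiltForm B v (p - (η, -1))) ((g T + 1) ^ 2 / 4) < ρ ∧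
      ρ < (R / 4) ^ 2 := by
    refine exists_between (max_lt hp ?_)
    nlinarith
  have hfence : ∀ t ∈ Icc t₁ T, tiltForm B v (φ t - (η, -1)) ≤ ρ := by
    have hder : ∀ t ∈ Icc t₁ T, HasDerivWithinAt (fun t => tiltForm B v (φ t - (η, -1)))
        (2 * B (tilt v (φ t - (η, -1))) (tilt v ((f t (α t), (F (φ t)).2) - 0))) (Icc t₁ T) t :=
      fun t ht => hasDerivWithinAt_tiltForm_sub h.symm (hφ t ht) (hasDerivWithinAt_const _ _ _)
    refine image_le_of_deriv_right_lt_deriv_boundary' (fun t ht => (hder t ht).continuousWithinAt)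
      (fun t ht => (hder t (Ico_subset_Icc_self ht)).mono_of_mem_nhdsWithin
        (Icc_mem_nhdsGE_of_mem ht)) ?_ continuousOn_const
      (fun t _ => hasDerivWithinAt_const _ _ _) ?_
    · rw [hφ1]
      exact (le_max_left _ _).trans hρ.le
    · intro t ht hteq
      have ht' := Ico_subset_Icc_self ht
      have hlt : tiltForm B v (φ t - (η, -1)) < (R / 4) ^ 2 := hteq.trans_lt hρR
      have hmem : φ t ∈ cylinder η R := h.mem_cylinder hlt (hgmem t ht').1 (hgT t ht')
      have h1 := h.dissipative.transverse _ hmem _ h.base_mem_cylinder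
      rw [hteq, h.map_base] at h1
      rw [hFφ t ht' hlt]
      refine h1.trans_lt ?_
      have h2 : (φ t - (η, -1)).2 = g t + 1 := by simp [φ]
      have h3 : (g t + 1) ^ 2 ≤ (g T + 1) ^ 2 := by
        have := h.neg_one_lt t
        have := hgT t ht'
        exact pow_le_pow_left₀ (by linarith) (by linarith) 2
      have h4 : (g T + 1) ^ 2 / 4 < ρ := (le_max_right _ _).trans_lt hρ
      rw [h2]
      nlinarith [h.κ_pos]
  refine ⟨φ, hφ1, fun t ht => ?_, fun t ht => ⟨rfl, (hfence t ht).trans_lt hρR⟩⟩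
  have hlt := (hfence t ht).trans_lt hρR
  refine ⟨h.cylinder_subset (h.mem_cylinder hlt (hgmem t ht).1 (hgT t ht)), ?_⟩
  have := hφ t ht
  rwa [hFφ t ht hlt] at this

end IsDissipativeSkewProduct

end Pullback

/-! ### The pullback limit -/

section PullbackLimit

variable {E : Type*} [NormedAddCommGroup E] [NormedSpace ℝ E]

namespace IsDissipativeSkewProduct

variable {F : E × ℝ → E × ℝ} {P : Set (E × ℝ)} {B : E →L[ℝ] E →L[ℝ] ℝ} {v η : E} {κ : ℝ}
  {g : ℝ → ℝ} {R T : ℝ}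

/-- Two solutions with the same second component approach each other exponentially. -/
lemma norm_sub_sq_le (h : IsDissipativeSkewProduct F P B v η κ g R T) {φ ψ : ℝ → E × ℝ} {t₁ t₂ : ℝ}
    (h12 : t₁ ≤ t₂) (hφ : IsSolutionOn F P φ (Icc t₁ t₂)) (hψ : IsSolutionOn F P ψ (Icc t₁ t₂))
    (hφD : ∀ t ∈ Icc t₁ t₂, φ t ∈ cylinder η R) (hψD : ∀ t ∈ Icc t₁ t₂, ψ t ∈ cylinder η R)
    (heq : ∀ t ∈ Icc t₁ t₂, (φ t).2 = (ψ t).2) :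
    ‖φ t₂ - ψ t₂‖ ^ 2 ≤ Real.exp (-κ * (t₂ - t₁)) * tiltForm B v (φ t₁ - ψ t₁) := by
  have h1 := h.dissipative.tiltForm_sub_le h.symm h.κ_pos (by linarith [h.κ_pos]) (by linarith) h12
    hφ hψ hφD hψD
  have h2 : ∀ t ∈ Icc t₁ t₂, (φ t - ψ t).2 = 0 := fun t ht => by simp [heq t ht]
  rw [h2 _ (left_mem_Icc.2 h12), h2 _ (right_mem_Icc.2 h12)] at h1
  have h3 : ‖φ t₂ - ψ t₂‖ = ‖tilt v (φ t₂ - ψ t₂)‖ := by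
    rw [tilt_apply, Prod.norm_def, h2 _ (right_mem_Icc.2 h12)]
    simp
  rw [h3]
  refine (h.norm_tilt_sq_le _).trans ?_
  simpa using h1

/-- The pullback limit: a solution on `(-∞, T]` over `g`, the limit of the solutions that start on
the axis of the tube at times tending to `-∞`. -/
lemma exists_backward_solution [CompleteSpace E]
    (h : IsDissipativeSkewProduct F P B v η κ g R T) :
    ∃ ψ : ℝ → E × ℝ, IsSolutionOn F P ψ (Iic T) ∧
      ∀ t ≤ T, (ψ t).2 = g t ∧ tiltForm B v (ψ t - (η, -1)) < (R / 4) ^ 2 := by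
  have hκ := h.κ_pos
  obtain ⟨C, hC⟩ := exists_tiltForm_sub_le B v η R
  have hstart : ∀ k : ℕ, ∃ φ : ℝ → E × ℝ, φ (T - k) = (η + (g (T - k) + 1) • v, g (T - k)) ∧
      IsSolutionOn F P φ (Icc (T - k) T) ∧ ∀ t ∈ Icc (T - (k : ℝ)) T,
        (φ t).2 = g t ∧ tiltForm B v (φ t - (η, -1)) < (R / 4) ^ 2 := by
    intro k
    refine h.exists_forward_solution (by simp) rfl ?_
    have : tilt v ((η + (g (T - k) + 1) • v, g (T - k)) - (η, -1)) = 0 := by simp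
    have hR := h.R_pos
    rw [tiltForm, this, map_zero]
    positivity
  choose φ hφ0 hφsol hφ using hstart
  have hcyl : ∀ (k : ℕ), ∀ t ∈ Icc (T - (k : ℝ)) T, φ k t ∈ cylinder η R := by
    intro k t ht
    obtain ⟨h1, h2⟩ := hφ k t ht
    exact h.mem_cylinder h2 (by rw [h1]; exact (h.neg_one_lt t).le)
      (by rw [h1]; exact h.strictMono.monotone ht.2)
  -- By comparison with the equilibrium, the approximations lie in the cone.
  have hcone : ∀ (k : ℕ), ∀ t ∈ Icc (T - (k : ℝ)) T,
      tiltForm B v (φ k t - (η, -1)) ≤ 2 * (κ / 4) / κ * (g t + 1) ^ 2 := by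
    intro k t ht
    have h1 := h.dissipative.tiltForm_sub_le h.symm hκ (by linarith) (by linarith) ht.1
      ((hφsol k).mono (Icc_subset_Icc_right ht.2)) (h.isSolutionOn_base _)
      (fun s hs => hcyl k s ⟨hs.1, hs.2.trans ht.2⟩) (fun s _ => h.base_mem_cylinder)
    have h2 : tilt v (φ k (T - k) - (η, -1)) = 0 := by simp [hφ0]
    have h3 : (φ k t - (η, -1)).2 = g t + 1 := by simp [(hφ k t ht).1]
    rw [h3, tiltForm.eq_1 B v (φ k (T - k) - (η, -1)), h2, map_zero] at h1
    have h4 : Real.exp (-κ * (t - (T - k))) * (0 - 2 * (κ / 4) / κ *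
        (φ k (T - k) - (η, -1)).2 ^ 2) ≤ 0 := by
      refine mul_nonpos_of_nonneg_of_nonpos (Real.exp_pos _).le ?_
      rw [zero_sub, neg_nonpos]
      positivity
    linarith
  have hdist : ∀ (k l : ℕ), k ≤ l → ∀ t ∈ Icc (T - (k : ℝ)) T,
      ‖φ k t - φ l t‖ ^ 2 ≤ Real.exp (-κ * (t - (T - k))) * C := by
    intro k l hkl t ht
    have hkl' : (k : ℝ) ≤ l := by exact_mod_cast hkl
    have hsub : ∀ s ∈ Icc (T - (k : ℝ)) t, s ∈ Icc (T - (k : ℝ)) T ∧ s ∈ Icc (T - (l : ℝ)) T :=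
      fun s hs => ⟨⟨hs.1, hs.2.trans ht.2⟩, ⟨by linarith [hs.1], hs.2.trans ht.2⟩⟩
    refine (h.norm_sub_sq_le ht.1 ((hφsol k).mono fun s hs => (hsub s hs).1)
      ((hφsol l).mono fun s hs => (hsub s hs).2) (fun s hs => hcyl k s (hsub s hs).1)
      (fun s hs => hcyl l s (hsub s hs).2)
      (fun s hs => by rw [(hφ k s (hsub s hs).1).1, (hφ l s (hsub s hs).2).1])).trans ?_
    gcongr
    have := hsub _ (left_mem_Icc.2 ht.1)
    exact hC _ (hcyl k _ this.1) _ (hcyl l _ this.2)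
  have hmem : ∀ t ≤ T, ∀ᶠ k : ℕ in atTop, t ∈ Icc (T - (k : ℝ)) T := by
    intro t ht
    filter_upwards [tendsto_natCast_atTop_atTop.eventually_ge_atTop (T - t)] with k hk
    exact ⟨by linarith, ht⟩
  have hlim : ∀ t : ℝ, ∃ y : E × ℝ, t ≤ T → Tendsto (fun k => φ k t) atTop (𝓝 y) := by
    intro t
    by_cases ht : t ≤ T
    · obtain ⟨k₀, hk₀⟩ := eventually_atTop.1 (hmem t ht)
      have hexp : Tendsto (fun k : ℕ => √(Real.exp (-κ * (t - (T - k))) * C)) atTop (𝓝 0) := by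
        have h1 : Tendsto (fun k : ℕ => T - (k : ℝ)) atTop atBot :=
          tendsto_atBot_add_const_left _ T (tendsto_neg_atTop_atBot.comp tendsto_natCast_atTop_atTop)
        have h2 := (tendsto_exp_neg_mul_atTop hκ t C).comp h1
        simpa using h2.sqrt
      have hcau : CauchySeq fun k => φ (k + k₀) t := by
        refine cauchySeq_of_le_tendsto_0' _ (fun k l hkl => ?_)
          (hexp.comp (tendsto_add_atTop_nat k₀))
        rw [dist_eq_norm]
        exact Real.le_sqrt_of_sq_le (hdist _ _ (by omega) t (hk₀ _ (by omega)))
      obtain ⟨y, hy⟩ := cauchySeq_tendsto_of_complete hcau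
      exact ⟨y, fun _ => (tendsto_add_atTop_iff_nat k₀).1 hy⟩
    · exact ⟨0, fun h' => absurd h' ht⟩
  choose ψ hψ using hlim
  have hψ2 : ∀ t ≤ T, (ψ t).2 = g t := by
    intro t ht
    refine tendsto_nhds_unique ((continuous_snd.tendsto _).comp (hψ t ht)) ?_
    refine tendsto_const_nhds.congr' ?_
    filter_upwards [hmem t ht] with k hk
    exact (hφ k t hk).1.symm
  have hψform : ∀ t ≤ T, tiltForm B v (ψ t - (η, -1)) < (R / 4) ^ 2 := by
    intro t ht
    have h1 : tiltForm B v (ψ t - (η, -1)) ≤ 2 * (κ / 4) / κ * (g t + 1) ^ 2 := by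
      refine le_of_tendsto (((continuous_tiltForm B v).tendsto _).comp
        ((hψ t ht).sub_const (η, -1))) ?_
      filter_upwards [hmem t ht] with k hk
      exact hcone k t hk
    have h2 : 2 * (κ / 4) / κ = 1 / 2 := by field_simp; norm_num
    rw [h2] at h1
    have h3 : g t + 1 ≤ R / 4 := by linarith [h.height_le', h.strictMono.monotone ht]
    have h4 := h.neg_one_lt t
    nlinarith
  refine ⟨ψ, ?_, fun t ht => ⟨hψ2 t ht, hψform t ht⟩⟩
  -- The solution that starts on `ψ` at time `t₁` is `ψ`, as both are limits of the `φ k`.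
  have hseg : ∀ t₁ ≤ T, IsSolutionOn F P ψ (Icc t₁ T) := by
    intro t₁ ht₁
    obtain ⟨χ, hχ0, hχsol, hχ⟩ := h.exists_forward_solution ht₁ (hψ2 t₁ ht₁) (hψform t₁ ht₁)
    have hχcyl : ∀ t ∈ Icc t₁ T, χ t ∈ cylinder η R := by
      intro t ht
      obtain ⟨h1, h2⟩ := hχ t ht
      exact h.mem_cylinder h2 (by rw [h1]; exact (h.neg_one_lt t).le)
        (by rw [h1]; exact h.strictMono.monotone ht.2)
    have heq : ∀ t ∈ Icc t₁ T, χ t = ψ t := by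
      intro t ht
      refine tendsto_nhds_unique (f := fun k => φ k t) (l := atTop) ?_ (hψ t ht.2)
      rw [tendsto_iff_norm_sub_tendsto_zero]
      have h1 : Tendsto (fun k => √(Real.exp (-κ * (t - t₁)) * tiltForm B v (φ k t₁ - χ t₁)))
          atTop (𝓝 0) := by
        have h2 := (((continuous_tiltForm B v).tendsto _).comp
          ((hψ t₁ ht₁).sub_const (χ t₁))).const_mul (Real.exp (-κ * (t - t₁)))
        rw [hχ0, sub_self] at h2
        have h3 : tiltForm B v 0 = 0 := by simp [tiltForm]
        rw [h3, mul_zero] at h2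
        simpa [hχ0] using h2.sqrt
      refine squeeze_zero' (Eventually.of_forall fun _ => norm_nonneg _) ?_ h1
      filter_upwards [hmem t₁ ht₁] with k hk
      have hsub : ∀ s ∈ Icc t₁ t, s ∈ Icc (T - (k : ℝ)) T ∧ s ∈ Icc t₁ T :=
        fun s hs => ⟨⟨hk.1.trans hs.1, hs.2.trans ht.2⟩, ⟨hs.1, hs.2.trans ht.2⟩⟩
      refine Real.le_sqrt_of_sq_le ?_
      exact h.norm_sub_sq_le ht.1 ((hφsol k).mono fun s hs => (hsub s hs).1)
        (hχsol.mono fun s hs => (hsub s hs).2) (fun s hs => hcyl k s (hsub s hs).1)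
        (fun s hs => hχcyl s (hsub s hs).2)
        (fun s hs => by rw [(hφ k s (hsub s hs).1).1, (hχ s (hsub s hs).2).1])
    intro t ht
    rw [← heq t ht]
    exact ⟨(hχsol t ht).1, (hχsol t ht).2.congr (fun s hs => (heq s hs).symm) (heq t ht).symm⟩
  intro t ht
  have h1 := hseg (t - 1) (by linarith [mem_Iic.1 ht]) t ⟨by linarith, ht⟩
  refine ⟨h1.1, h1.2.mono_of_mem_nhdsWithin ?_⟩
  rw [← Ici_inter_Iic, inter_comm]
  exact inter_mem_nhdsWithin _ (Ici_mem_nhds (by linarith))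

end IsDissipativeSkewProduct

end PullbackLimit

/-! ### Centre manifolds and backward orbits -/

section CentreManifold

lemma IsSolutionOn.comp_add_const {X : Type*} [NormedAddCommGroup X] [NormedSpace ℝ X] {F : X → X}
    {P : Set X} {φ : ℝ → X} {I I' : Set ℝ} (h : IsSolutionOn F P φ I) (c : ℝ)
    (hI : ∀ t ∈ I', t + c ∈ I) : IsSolutionOn F P (fun t => φ (t + c)) I' := by
  intro t ht
  refine ⟨(h _ (hI t ht)).1, ?_⟩
  have h1 := (h _ (hI t ht)).2.scomp t ((hasDerivAt_id t).add_const c).hasDerivWithinAt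
    (s := I') hI
  simpa [Function.comp_def] using h1

/-- A solution on `(-∞, 0]` and one on `[0, b]` that agree at time `0` can be concatenated. -/
lemma IsSolutionOn.concat {X : Type*} [NormedAddCommGroup X] [NormedSpace ℝ X] {F : X → X}
    {P : Set X} {φ ψ : ℝ → X} {b : ℝ} (hψ : IsSolutionOn F P ψ (Iic 0))
    (hφ : IsSolutionOn F P φ (Icc 0 b)) (h0 : ψ 0 = φ 0) :
    IsSolutionOn F P (fun t => if t ≤ 0 then ψ t else φ t) (Iic b) := by
  set ω : ℝ → X := fun t => if t ≤ 0 then ψ t else φ t with hω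
  have h1 : ∀ t ≤ 0, ω t = ψ t := fun t ht => if_pos ht
  have h2 : ∀ t, 0 ≤ t → ω t = φ t := by
    intro t ht
    rcases ht.eq_or_lt with rfl | ht
    · rw [h1 _ le_rfl, h0]
    · exact if_neg (not_le.2 ht)
  have hl : IsSolutionOn F P ω (Iic 0) := by
    intro t ht
    rw [h1 t ht]
    exact ⟨(hψ t ht).1, (hψ t ht).2.congr (fun s hs => h1 s hs) (h1 t ht)⟩
  have hr : IsSolutionOn F P ω (Icc 0 b) := by
    intro t ht
    rw [h2 t ht.1]
    exact ⟨(hφ t ht).1, (hφ t ht).2.congr (fun s hs => h2 s hs.1) (h2 t ht.1)⟩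
  intro t ht
  rcases lt_trichotomy t 0 with ht0 | rfl | ht0
  · exact ⟨(hl t ht0.le).1, (hl t ht0.le).2.mono_of_mem_nhdsWithin
      (mem_nhdsWithin_of_mem_nhds (Iic_mem_nhds ht0))⟩
  · refine ⟨(hl 0 (mem_Iic.2 le_rfl)).1, ?_⟩
    have := (hl 0 (mem_Iic.2 le_rfl)).2.union (hr 0 ⟨le_rfl, ht⟩).2
    rwa [Iic_union_Icc_eq_Iic ht] at this
  · refine ⟨(hr t ⟨ht0.le, ht⟩).1, (hr t ⟨ht0.le, ht⟩).2.mono_of_mem_nhdsWithin ?_⟩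
    rw [← Ici_inter_Iic, inter_comm]
    exact inter_mem_nhdsWithin _ (Ici_mem_nhds ht0)

/-- The points with a backward orbit that stays in `N`. -/
def backwardSet {X : Type*} [NormedAddCommGroup X] [NormedSpace ℝ X] (F : X → X) (P N : Set X) :
    Set X :=
  {y | ∃ φ : ℝ → X, φ 0 = y ∧ IsSolutionOn F P φ (Iic 0) ∧ ∀ t ≤ 0, φ t ∈ N}

lemma mem_backwardSet_of_le {X : Type*} [NormedAddCommGroup X] [NormedSpace ℝ X] {F : X → X}
    {P N : Set X} {φ : ℝ → X} {c : ℝ} (hφ : IsSolutionOn F P φ (Iic c)) (hN : ∀ t ≤ c, φ t ∈ N) :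
    φ c ∈ backwardSet F P N :=
  ⟨fun t => φ (t + c), by simp, hφ.comp_add_const c fun t ht => by
    simp only [mem_Iic] at ht ⊢; linarith, fun t ht => hN _ (by linarith)⟩

lemma alphaLimit_subset_singleton {X : Type*} [NormedAddCommGroup X] {φ : ℝ → X} {y : X}
    (hφ : Tendsto φ atBot (𝓝 y)) : alphaLimit φ ⊆ {y} := by
  intro z hz
  rw [mem_singleton_iff, ← dist_le_zero]
  refine le_of_forall_pos_le_add fun ε hε => ?_
  obtain ⟨T, hT⟩ := eventually_atBot.1 (hφ.eventually (Metric.closedBall_mem_nhds y hε))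
  have h1 : z ∈ closure (φ '' Iio (min T (-1))) := by
    simp only [alphaLimit, mem_iInter] at hz
    exact hz _ (mem_Iio.2 ((min_le_right _ _).trans_lt (by norm_num)))
  have h2 : closure (φ '' Iio (min T (-1))) ⊆ Metric.closedBall y ε := by
    refine closure_minimal ?_ Metric.isClosed_closedBall
    rintro _ ⟨t, ht, rfl⟩
    exact hT t ((mem_Iio.1 ht).le.trans (min_le_left _ _))
  simpa using h2 h1

variable {E : Type*} [NormedAddCommGroup E] [NormedSpace ℝ E]

namespace IsDissipativeSkewProduct

variable {F : E × ℝ → E × ℝ} {P : Set (E × ℝ)} {B : E →L[ℝ] E →L[ℝ] ℝ} {v η : E} {κ : ℝ}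
  {g : ℝ → ℝ} {R T : ℝ}

lemma base_mem_tube (h : IsDissipativeSkewProduct F P B v η κ g R T) :
    ((η, -1) : E × ℝ) ∈ tube B v η (R / 4) (g T + 1) := by
  have := h.R_pos
  refine ⟨?_, ?_⟩
  · simp only [sub_self, tiltForm, map_zero]
    positivity
  · simpa using h.height_pos

lemma base_mem_backwardSet (h : IsDissipativeSkewProduct F P B v η κ g R T) :
    ((η, -1) : E × ℝ) ∈ backwardSet F P (tube B v η (R / 4) (g T + 1)) :=
  ⟨fun _ => (η, -1), rfl, h.isSolutionOn_base _, fun _ _ => h.base_mem_tube⟩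

lemma backwardSet_subset {F : E × ℝ → E × ℝ} {P N : Set (E × ℝ)} :
    backwardSet F P N ⊆ P ∩ N := by
  rintro _ ⟨φ, rfl, h1, h2⟩
  exact ⟨(h1 0 (mem_Iic.2 le_rfl)).1, h2 0 le_rfl⟩

lemma snd_mem_Ico (h : IsDissipativeSkewProduct F P B v η κ g R T) {p : E × ℝ}
    (hp : p ∈ P ∩ tube B v η (R / 4) (g T + 1)) : p.2 ∈ Ico (-1) (g T) :=
  ⟨h.neg_one_le p hp.1, by linarith [(abs_lt.1 hp.2.2).2]⟩

lemma mem_tube_of_lt (h : IsDissipativeSkewProduct F P B v η κ g R T) {p : E × ℝ} {t : ℝ}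
    (ht : t < T) (hp2 : p.2 = g t) (hp : tiltForm B v (p - (η, -1)) < (R / 4) ^ 2) :
    p ∈ tube B v η (R / 4) (g T + 1) := by
  refine ⟨hp, ?_⟩
  rw [hp2, abs_of_pos (by linarith [h.neg_one_lt t])]
  linarith [h.strictMono ht]

/-- The set of backward orbits is a graph over the axis, with slope at most `1 / √2`. -/
lemma tiltForm_sub_le_of_mem_backwardSet (h : IsDissipativeSkewProduct F P B v η κ g R T)
    {y z : E × ℝ} (hy : y ∈ backwardSet F P (tube B v η (R / 4) (g T + 1)))
    (hz : z ∈ backwardSet F P (tube B v η (R / 4) (g T + 1))) :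
    tiltForm B v (y - z) ≤ 1 / 2 * (y.2 - z.2) ^ 2 := by
  obtain ⟨φ, rfl, hφ, hφN⟩ := hy
  obtain ⟨ψ, rfl, hψ, hψN⟩ := hz
  have hκ := h.κ_pos
  obtain ⟨C, hC⟩ := exists_tiltForm_sub_le B v η R
  have h1 := h.dissipative.tiltForm_le_of_backward h.symm hκ (by linarith) (by linarith) hC hφ hψ
    (fun t ht => h.mem_cylinder_of_mem_tube (hφN t ht) (hφ t ht).1)
    (fun t ht => h.mem_cylinder_of_mem_tube (hψN t ht) (hψ t ht).1)
  have h2 : 2 * (κ / 4) / κ = 1 / 2 := by field_simp; norm_num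
  rwa [h2] at h1

lemma norm_tilt_sub_le_of_mem_backwardSet (h : IsDissipativeSkewProduct F P B v η κ g R T)
    {y z : E × ℝ} (hy : y ∈ backwardSet F P (tube B v η (R / 4) (g T + 1)))
    (hz : z ∈ backwardSet F P (tube B v η (R / 4) (g T + 1))) :
    ‖tilt v (y - z)‖ ≤ |y.2 - z.2| := by
  refine abs_le_of_sq_le_sq' (b := |y.2 - z.2|) ?_ (abs_nonneg _) |>.2
  rw [sq_abs]
  have := h.tiltForm_sub_le_of_mem_backwardSet hy hz
  have := h.norm_tilt_sq_le (y - z)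
  nlinarith [sq_nonneg (y.2 - z.2)]

lemma eq_of_mem_backwardSet (h : IsDissipativeSkewProduct F P B v η κ g R T)
    {y z : E × ℝ} (hy : y ∈ backwardSet F P (tube B v η (R / 4) (g T + 1)))
    (hz : z ∈ backwardSet F P (tube B v η (R / 4) (g T + 1))) (hyz : y.2 = z.2) : y = z := by
  have h1 := h.norm_tilt_sub_le_of_mem_backwardSet hy hz
  rw [hyz, sub_self, abs_zero, norm_le_zero_iff, tilt_apply] at h1
  have h2 : y.1 = z.1 := by simpa [hyz, sub_eq_zero] using h1
  exact Prod.ext h2 hyz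

lemma norm_sub_base_le_of_mem_backwardSet (h : IsDissipativeSkewProduct F P B v η κ g R T)
    {y : E × ℝ} (hy : y ∈ backwardSet F P (tube B v η (R / 4) (g T + 1))) :
    ‖y - (η, -1)‖ ≤ (1 + ‖v‖) * |y.2 + 1| := by
  have h1 := h.norm_tilt_sub_le_of_mem_backwardSet hy h.base_mem_backwardSet
  simp only [sub_neg_eq_add] at h1
  have h2 : (y - (η, -1)).1 = tilt v (y - (η, -1)) + (y.2 + 1) • v := by simp
  refine max_le ?_ ?_
  · rw [h2]
    refine (norm_add_le _ _).trans ?_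
    rw [norm_smul, Real.norm_eq_abs]
    linarith
  · simp only [Prod.snd_sub, sub_neg_eq_add, Real.norm_eq_abs]
    nlinarith [abs_nonneg (y.2 + 1), norm_nonneg v]

lemma continuous_time (h : IsDissipativeSkewProduct F P B v η κ g R T) : Continuous g :=
  continuous_iff_continuousAt.2 fun t => (h.hasDerivAt η t).continuousAt

lemma exists_eq_of_mem_Ioo (h : IsDissipativeSkewProduct F P B v η κ g R T) {s : ℝ}
    (hs : s ∈ Ioo (-1) (g T)) : ∃ t < T, g t = s := by
  obtain ⟨t, rfl⟩ : s ∈ range g := by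
    obtain ⟨t, ht⟩ := (h.tendsto.eventually_lt_const hs.1).exists
    exact mem_range_of_exists_le_of_exists_ge h.continuous_time ⟨t, ht.le⟩ ⟨T, hs.2.le⟩
  exact ⟨t, h.strictMono.lt_iff_lt.1 hs.2, rfl⟩

/-- Over each point of the axis there is a backward orbit in the tube; it tends to the equilibrium
and stays below its end point. -/
lemma exists_backward_orbit [CompleteSpace E] (h : IsDissipativeSkewProduct F P B v η κ g R T)
    {s : ℝ} (hs : s ∈ Ico (-1) (g T)) :
    ∃ φ : ℝ → E × ℝ, (φ 0).2 = s ∧ IsSolutionOn F P φ (Iic 0) ∧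
      (∀ t ≤ 0, φ t ∈ tube B v η (R / 4) (g T + 1) ∧ (φ t).2 ≤ s) ∧
      Tendsto φ atBot (𝓝 (η, -1)) := by
  rcases hs.1.eq_or_lt with rfl | hs1
  · exact ⟨fun _ => (η, -1), rfl, h.isSolutionOn_base _, fun _ _ => ⟨h.base_mem_tube, le_rfl⟩,
      tendsto_const_nhds⟩
  obtain ⟨t₀, ht₀, rfl⟩ := h.exists_eq_of_mem_Ioo ⟨hs1, hs.2⟩
  obtain ⟨ψ, hψsol, hψ⟩ := h.exists_backward_solution
  have hψN : ∀ t < T, ψ t ∈ tube B v η (R / 4) (g T + 1) := fun t ht =>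
    h.mem_tube_of_lt ht (hψ t ht.le).1 (hψ t ht.le).2
  refine ⟨fun t => ψ (t + t₀), ?_, ?_, fun t ht => ⟨hψN _ (by linarith), ?_⟩, ?_⟩
  · simpa using (hψ t₀ ht₀.le).1
  · exact hψsol.comp_add_const t₀ fun t ht => by
      simp only [mem_Iic] at ht ⊢; linarith
  · rw [(hψ _ (by linarith)).1]
    exact h.strictMono.monotone (by linarith)
  · have h1 : Tendsto ψ atBot (𝓝 (η, -1)) := by
      rw [tendsto_iff_norm_sub_tendsto_zero]
      have h2 : Tendsto (fun t => (1 + ‖v‖) * |g t + 1|) atBot (𝓝 0) := by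
        simpa using ((h.tendsto.add_const 1).abs).const_mul (1 + ‖v‖)
      refine squeeze_zero' (Eventually.of_forall fun _ => norm_nonneg _) ?_ h2
      filter_upwards [eventually_lt_atBot T] with t ht
      have h3 : ψ t ∈ backwardSet F P (tube B v η (R / 4) (g T + 1)) :=
        mem_backwardSet_of_le (hψsol.mono (Iic_subset_Iic.2 ht.le))
          fun s hs => hψN s (hs.trans_lt ht)
      have h4 := h.norm_sub_base_le_of_mem_backwardSet h3
      rwa [(hψ t ht.le).1] at h4
    exact h1.comp (tendsto_atBot_add_const_right _ t₀ tendsto_id)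

lemma backwardSet_eq_localUnstableSet [CompleteSpace E]
    (h : IsDissipativeSkewProduct F P B v η κ g R T) :
    backwardSet F P (tube B v η (R / 4) (g T + 1)) =
      localUnstableSet F P {(η, -1)} (tube B v η (R / 4) (g T + 1)) := by
  refine Subset.antisymm (fun y hy => ?_) ?_
  · obtain ⟨φ, h0, hφ, hφN, hlim⟩ := h.exists_backward_orbit (h.snd_mem_Ico (backwardSet_subset hy))
    refine ⟨φ, ?_, hφ, alphaLimit_subset_singleton hlim, fun t ht => (hφN t ht).1⟩
    exact h.eq_of_mem_backwardSet ⟨φ, rfl, hφ, fun t ht => (hφN t ht).1⟩ hy h0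
  · rintro y ⟨φ, h0, hφ, -, hφN⟩
    exact ⟨φ, h0, hφ, hφN⟩

lemma isInvariantRelTo_backwardSet (h : IsDissipativeSkewProduct F P B v η κ g R T) :
    IsInvariantRelTo F P (tube B v η (R / 4) (g T + 1))
      (backwardSet F P (tube B v η (R / 4) (g T + 1))) := by
  rintro φ a b ha hb hφ ⟨ψ, hψ0, hψ, hψN⟩ hφN t ht
  rcases le_total 0 t with ht0 | ht0
  · have hsol := hψ.concat (hφ.mono (Icc_subset_Icc ha ht.2)) hψ0
    have hmem := mem_backwardSet_of_le (N := tube B v η (R / 4) (g T + 1)) hsol (fun s hs => by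
      split_ifs with hs0
      · exact hψN s hs0
      · exact hφN s ⟨ha.trans (not_le.1 hs0).le, hs.trans ht.2⟩)
    split_ifs at hmem with ht1
    · obtain rfl : t = 0 := le_antisymm ht1 ht0
      rwa [hψ0] at hmem
    · exact hmem
  · obtain ⟨K, hK⟩ := h.lipschitz
    have hφ' : IsSolutionOn F P φ (Icc a 0) := hφ.mono (Icc_subset_Icc_right hb)
    have hψ' : IsSolutionOn F P ψ (Icc a 0) := hψ.mono Icc_subset_Iic_self
    have heq : EqOn φ ψ (Icc a 0) := by
      refine ODE_solution_unique_of_mem_Icc_left (v := fun _ => F) (s := fun _ => cylinder η R)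
        (fun _ _ => hK) (fun s hs => (hφ' s hs).2.continuousWithinAt) (fun s hs => ?_)
        (fun s hs => ?_) (fun s hs => (hψ' s hs).2.continuousWithinAt) (fun s hs => ?_)
        (fun s hs => ?_) hψ0.symm
      · exact (hφ' s (Ioc_subset_Icc_self hs)).2.mono_of_mem_nhdsWithin (Icc_mem_nhdsLE_of_mem hs)
      · exact h.mem_cylinder_of_mem_tube (hφN s ⟨hs.1.le, hs.2.trans hb⟩)
          (hφ' s (Ioc_subset_Icc_self hs)).1
      · exact (hψ' s (Ioc_subset_Icc_self hs)).2.mono_of_mem_nhdsWithin (Icc_mem_nhdsLE_of_mem hs)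
      · exact h.mem_cylinder_of_mem_tube (hψN s hs.2) (hψ s hs.2).1
    rw [heq ⟨ht.1, ht0⟩]
    exact mem_backwardSet_of_le (hψ.mono (Iic_subset_Iic.2 ht0)) fun s hs => hψN s (hs.trans ht0)

lemma mem_centreDomain_iff
    (hc : ∀ p, p ∈ centreSubspace (jacobianAt F P (η, -1)) ↔ p.1 = p.2 • v)
    {N : Set (E × ℝ)} {p : E × ℝ} :
    p ∈ centreDomain F P (η, -1) N ↔ p ∈ P ∩ N ∧ p = (η + (p.2 + 1) • v, p.2) := by
  rw [centreDomain, mem_ofPred_eq, hc, mem_inter_iff, and_assoc]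
  refine and_congr_right fun _ => and_congr_right fun _ => ?_
  rw [Prod.ext_iff]
  simp [sub_eq_iff_eq_add']

lemma mk_mem_centreDomain
    (hc : ∀ p, p ∈ centreSubspace (jacobianAt F P (η, -1)) ↔ p.1 = p.2 • v)
    (h : IsDissipativeSkewProduct F P B v η κ g R T) {s : ℝ}
    (hs : s ∈ Ico (-1) (g T)) :
    (η + (s + 1) • v, s) ∈ centreDomain F P (η, -1) (tube B v η (R / 4) (g T + 1)) := by
  have hR := h.R_pos
  have h0 : tiltForm B v ((η + (s + 1) • v, s) - (η, -1)) < (R / 4) ^ 2 := by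
    have : tilt v ((η + (s + 1) • v, s) - (η, -1)) = 0 := by simp
    rw [tiltForm, this, map_zero]
    positivity
  rw [mem_centreDomain_iff hc]
  refine ⟨⟨h.cylinder_subset (h.mem_cylinder h0 hs.1 hs.2.le), h0, ?_⟩, rfl⟩
  rw [abs_lt]
  constructor <;> linarith [hs.1, hs.2, h.height_pos]

lemma isLocalCentreManifold_backwardSet [CompleteSpace E]
    (hc : ∀ p, p ∈ centreSubspace (jacobianAt F P (η, -1)) ↔ p.1 = p.2 • v)
    (hsu : ∀ p, p ∈ stableSubspace (jacobianAt F P (η, -1)) ⊔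
      unstableSubspace (jacobianAt F P (η, -1)) ↔ p.2 = 0)
    (h : IsDissipativeSkewProduct F P B v η κ g R T)
    (hsmall : ∀ ε > 0, ∃ ρ > 0, IsDissipativeOn F (cylinder η ρ) B v κ ε) :
    IsLocalCentreManifold F P (η, -1) (tube B v η (R / 4) (g T + 1))
      (backwardSet F P (tube B v η (R / 4) (g T + 1))) := by
  refine ⟨?_, backwardSet_subset, h.isInvariantRelTo_backwardSet⟩
  set N := tube B v η (R / 4) (g T + 1) with hN
  have hκ := h.κ_pos
  choose! Φ hΦ0 hΦsol hΦN _ using fun s (hs : s ∈ Ico (-1) (g T)) => h.exists_backward_orbit hs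
  have hmem : ∀ s ∈ Ico (-1) (g T), Φ s 0 ∈ backwardSet F P N := fun s hs =>
    ⟨Φ s, rfl, hΦsol s hs, fun t ht => (hΦN s hs t ht).1⟩
  have hIco : ∀ p ∈ centreDomain F P (η, -1) N, p.2 ∈ Ico (-1) (g T) := fun p hp =>
    h.snd_mem_Ico ((mem_centreDomain_iff hc).1 hp).1
  have hbase : Φ (-1) 0 = (η, -1) :=
    have hs : (-1 : ℝ) ∈ Ico (-1) (g T) := ⟨le_rfl, h.neg_one_lt T⟩
    h.eq_of_mem_backwardSet (hmem _ hs) h.base_mem_backwardSet (hΦ0 _ hs)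
  have hadd : ∀ p ∈ centreDomain F P (η, -1) N,
      p + (tilt v (Φ p.2 0 - (η, -1)), (0 : ℝ)) = Φ p.2 0 := by
    intro p hp
    have h1 := congrArg Prod.fst ((mem_centreDomain_iff hc).1 hp).2
    have h2 := hΦ0 p.2 (hIco p hp)
    ext
    · simp only [Prod.fst_add, tilt_apply, Prod.fst_sub, Prod.snd_sub, h2, sub_neg_eq_add]
      rw [h1]
      module
    · simp [h2]
  refine ⟨fun p => (tilt v (Φ p.2 0 - (η, -1)), 0), 1, ?_, ?_, ?_, ?_, ?_⟩
  · refine LipschitzOnWith.of_dist_le_mul fun p hp q hq => ?_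
    have h1 := h.norm_tilt_sub_le_of_mem_backwardSet (hmem _ (hIco p hp)) (hmem _ (hIco q hq))
    rw [hΦ0 _ (hIco p hp), hΦ0 _ (hIco q hq)] at h1
    have h2 : tilt v (Φ p.2 0 - (η, -1)) - tilt v (Φ q.2 0 - (η, -1)) =
        tilt v (Φ p.2 0 - Φ q.2 0) := by
      rw [← map_sub, sub_sub_sub_cancel_right]
    rw [dist_eq_norm, Prod.mk_sub_mk, h2, sub_self, Prod.norm_mk, norm_zero,
      max_eq_left (norm_nonneg _), NNReal.coe_one, one_mul, dist_eq_norm]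
    exact h1.trans (norm_snd_le (p - q))
  · intro p _
    exact (hsu _).2 rfl
  · simp [hbase]
  · -- Near the equilibrium the orbits stay in smaller cylinders, where the cone is thinner.
    rw [hasFDerivWithinAt_iff_isLittleO, Asymptotics.isLittleO_iff]
    intro c hc0
    have hε : 0 < min (κ / 4) (κ / 2 * c ^ 2) := by positivity
    obtain ⟨ρ, hρ, hdiss⟩ := hsmall _ hε
    have hρ' : 0 < ρ / (1 + ‖v‖) := by positivity
    filter_upwards [self_mem_nhdsWithin,
      mem_nhdsWithin_of_mem_nhds (Metric.ball_mem_nhds _ hρ')] with p hp hpρ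
    have hs := hIco p hp
    have hs0 : 0 ≤ p.2 + 1 := by linarith [hs.1]
    have hpn : |p.2 + 1| ≤ ‖p - (η, -1)‖ := by
      have := norm_snd_le (p - (η, -1))
      rwa [Prod.snd_sub, sub_neg_eq_add, Real.norm_eq_abs] at this
    have hsρ : (1 + ‖v‖) * (p.2 + 1) ≤ ρ := by
      rw [mem_ball_iff_norm, lt_div_iff₀ (by positivity)] at hpρ
      have := norm_nonneg v
      have := le_abs_self (p.2 + 1)
      nlinarith
    have hcyl : ∀ t ≤ 0, Φ p.2 t ∈ cylinder η ρ := by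
      intro t ht
      have h1 : Φ p.2 t ∈ backwardSet F P N :=
        mem_backwardSet_of_le ((hΦsol _ hs).mono (Iic_subset_Iic.2 ht))
          fun s hs' => (hΦN _ hs s (hs'.trans ht)).1
      have h2 := h.norm_sub_base_le_of_mem_backwardSet h1
      have h3 : -1 ≤ (Φ p.2 t).2 := h.neg_one_le _ (backwardSet_subset h1).1
      have h4 := (hΦN _ hs t ht).2
      have h5 : ‖Φ p.2 t - (η, -1)‖ ≤ ρ := by
        rw [abs_of_nonneg (by linarith)] at h2
        refine h2.trans (le_trans ?_ hsρ)
        gcongr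
      refine ⟨?_, h3, ?_⟩
      · rw [mem_closedBall_iff_norm]
        exact (norm_fst_le (Φ p.2 t - (η, -1))).trans h5
      · have := (le_abs_self _).trans ((norm_snd_le (Φ p.2 t - (η, -1))).trans h5)
        simp only [Prod.snd_sub] at this
        linarith
    obtain ⟨C, hC⟩ := exists_tiltForm_sub_le B v η ρ
    have h6 := hdiss.tiltForm_le_of_backward (P := P) h.symm hκ hε.le
      (by linarith [min_le_left (κ / 4) (κ / 2 * c ^ 2)]) hC (hΦsol _ hs)
      (h.isSolutionOn_base (Iic 0)) hcyl
      (fun _ _ => ⟨Metric.mem_closedBall_self hρ.le, le_rfl, by linarith⟩)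
    have h7 : 2 * min (κ / 4) (κ / 2 * c ^ 2) / κ ≤ c ^ 2 := by
      rw [div_le_iff₀ hκ]
      linarith [min_le_right (κ / 4) (κ / 2 * c ^ 2)]
    have h8 : (Φ p.2 0 - (η, -1)).2 = p.2 + 1 := by simp [hΦ0 _ hs]
    rw [h8] at h6
    have h9 : ‖tilt v (Φ p.2 0 - (η, -1))‖ ≤ c * |p.2 + 1| := by
      refine abs_le_of_sq_le_sq' ?_ (by positivity) |>.2
      rw [mul_pow, sq_abs]
      exact (h.norm_tilt_sq_le _).trans (h6.trans (by gcongr))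
    have h10 : ‖((tilt v (Φ p.2 0 - (η, -1)), 0) : E × ℝ) -
        (tilt v (Φ (-1) 0 - (η, -1)), 0) - (0 : E × ℝ →L[ℝ] E × ℝ) (p - (η, -1))‖ =
        ‖tilt v (Φ p.2 0 - (η, -1))‖ := by
      rw [hbase]
      simp [Prod.norm_def]
    exact h10.le.trans (h9.trans (by gcongr))
  · refine Subset.antisymm (fun y hy => ?_) ?_
    · have hs := h.snd_mem_Ico (backwardSet_subset hy)
      refine ⟨_, mk_mem_centreDomain hc h hs, ?_⟩
      dsimp only
      rw [hadd _ (mk_mem_centreDomain hc h hs)]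
      exact h.eq_of_mem_backwardSet (hmem _ hs) hy (hΦ0 _ hs)
    · rintro _ ⟨p, hp, rfl⟩
      dsimp only
      rw [hadd p hp]
      exact hmem _ (hIco p hp)

/-- Following a centre manifold forward from points further and further back in the past shows
that it consists of points of the pullback limit. -/
lemma eq_backwardSet_of_isLocalCentreManifold [CompleteSpace E]
    (hc : ∀ p, p ∈ centreSubspace (jacobianAt F P (η, -1)) ↔ p.1 = p.2 • v)
    (hsu : ∀ p, p ∈ stableSubspace (jacobianAt F P (η, -1)) ⊔
      unstableSubspace (jacobianAt F P (η, -1)) ↔ p.2 = 0)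
    (h : IsDissipativeSkewProduct F P B v η κ g R T) {W : Set (E × ℝ)}
    (hW : IsLocalCentreManifold F P (η, -1) (tube B v η (R / 4) (g T + 1)) W) :
    W = backwardSet F P (tube B v η (R / 4) (g T + 1)) := by
  obtain ⟨⟨k, -, -, hk, hk0, -, hWk⟩, hWN, hinv⟩ := hW
  set N := tube B v η (R / 4) (g T + 1) with hN
  have hsnd : ∀ p ∈ centreDomain F P (η, -1) N, (p + k p).2 = p.2 := by
    intro p hp
    simp [(hsu _).1 (hk p hp)]
  have hsurj : ∀ s ∈ Ico (-1) (g T), ∃ w ∈ W, w.2 = s := by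
    intro s hs
    have hp := mk_mem_centreDomain hc h hs
    rw [hWk]
    exact ⟨_, mem_image_of_mem _ hp, hsnd _ hp⟩
  have hinj : ∀ w ∈ W, ∀ w' ∈ W, w.2 = w'.2 → w = w' := by
    rw [hWk]
    rintro _ ⟨p, hp, rfl⟩ _ ⟨q, hq, rfl⟩ hpq
    dsimp only at hpq
    rw [hsnd p hp, hsnd q hq] at hpq
    have h1 := ((mem_centreDomain_iff hc).1 hp).2
    rw [hpq, ← ((mem_centreDomain_iff hc).1 hq).2] at h1
    rw [h1]
  have hbase : ((η, -1) : E × ℝ) ∈ W := by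
    rw [hWk]
    refine ⟨(η, -1), ?_, by simp [hk0]⟩
    simpa using mk_mem_centreDomain hc h (s := -1) ⟨le_rfl, h.neg_one_lt T⟩
  have hsub : W ⊆ backwardSet F P N := by
    intro w hw
    have hs := h.snd_mem_Ico (hWN hw)
    rcases hs.1.eq_or_lt with hs1 | hs1
    · rw [hinj w hw _ hbase hs1.symm]
      exact h.base_mem_backwardSet
    obtain ⟨t₀, ht₀, hgt₀⟩ := h.exists_eq_of_mem_Ioo ⟨hs1, hs.2⟩
    obtain ⟨ψ, hψsol, hψ⟩ := h.exists_backward_solution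
    obtain ⟨C, hC⟩ := exists_tiltForm_sub_le B v η R
    have hψcyl : ∀ t ≤ T, ψ t ∈ cylinder η R := fun t ht =>
      h.mem_cylinder (hψ t ht).2 (h.neg_one_le _ (hψsol t ht).1)
        (by rw [(hψ t ht).1]; exact h.strictMono.monotone ht)
    have hdist : ∀ t₁ ≤ t₀, ‖w - ψ t₀‖ ^ 2 ≤ Real.exp (-κ * (t₀ - t₁)) * C := by
      intro t₁ ht₁
      have ht₁T : t₁ < T := ht₁.trans_lt ht₀
      obtain ⟨w₁, hw₁, hw₁s⟩ := hsurj (g t₁) ⟨(h.neg_one_lt _).le, h.strictMono ht₁T⟩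
      obtain ⟨φ, hφ1, hφsol, hφ⟩ := h.exists_forward_solution ht₁T.le hw₁s (hWN hw₁).2.1
      have hφcyl : ∀ t ∈ Icc t₁ T, φ t ∈ cylinder η R := fun t ht =>
        h.mem_cylinder (hφ t ht).2 (h.neg_one_le _ (hφsol t ht).1)
          (by rw [(hφ t ht).1]; exact h.strictMono.monotone ht.2)
      have hφW : φ t₀ ∈ W := by
        have h1 := hinv (fun t => φ (t + t₁)) 0 (t₀ - t₁) le_rfl (by linarith)
          (hφsol.comp_add_const t₁ fun t ht => ⟨by linarith [ht.1], by linarith [ht.2]⟩)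
          (by simpa [hφ1] using hw₁)
          (fun t ht => h.mem_tube_of_lt (t := t + t₁) (by linarith [ht.2])
            (hφ _ ⟨by linarith [ht.1], by linarith [ht.2]⟩).1
            (hφ _ ⟨by linarith [ht.1], by linarith [ht.2]⟩).2)
          (t₀ - t₁) ⟨by linarith, le_rfl⟩
        simpa using h1
      have hw0 : w = φ t₀ := hinj _ hw _ hφW (by rw [(hφ t₀ ⟨ht₁, ht₀.le⟩).1, hgt₀])
      rw [hw0]
      refine (h.norm_sub_sq_le ht₁ (hφsol.mono (Icc_subset_Icc_right ht₀.le))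
        (hψsol.mono fun t ht => ht.2.trans ht₀.le) (fun t ht => hφcyl t ⟨ht.1, ht.2.trans ht₀.le⟩)
        (fun t ht => hψcyl t (ht.2.trans ht₀.le)) (fun t ht => ?_)).trans ?_
      · rw [(hφ t ⟨ht.1, ht.2.trans ht₀.le⟩).1, (hψ t (ht.2.trans ht₀.le)).1]
      · gcongr
        exact hC _ (hφcyl _ ⟨le_rfl, ht₁T.le⟩) _ (hψcyl _ ht₁T.le)
    have hlim : ‖w - ψ t₀‖ ^ 2 ≤ 0 := by
      refine ge_of_tendsto (tendsto_exp_neg_mul_atTop h.κ_pos t₀ C) ?_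
      filter_upwards [eventually_le_atBot t₀] with t₁ ht₁ using hdist t₁ ht₁
    have hw0 : w = ψ t₀ := by
      rw [← sub_eq_zero, ← norm_eq_zero]
      exact pow_eq_zero_iff two_ne_zero |>.1 (le_antisymm hlim (by positivity))
    rw [hw0]
    exact mem_backwardSet_of_le (hψsol.mono (Iic_subset_Iic.2 ht₀.le)) fun t ht =>
      h.mem_tube_of_lt (ht.trans_lt ht₀) (hψ t (ht.trans ht₀.le)).1 (hψ t (ht.trans ht₀.le)).2
  refine Subset.antisymm hsub fun y hy => ?_
  obtain ⟨w, hw, hwy⟩ := hsurj y.2 (h.snd_mem_Ico (backwardSet_subset hy))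
  rwa [← h.eq_of_mem_backwardSet (hsub hw) hy hwy]

end IsDissipativeSkewProduct

end CentreManifold

/-! ### The compactified system -/

section Compactification

lemma IsCoordinateTransformation.strictMono {g : ℝ → ℝ} (hg : IsCoordinateTransformation g) :
    StrictMono g :=
  strictMono_of_deriv_pos hg.deriv_pos

lemma IsCoordinateTransformation.augmentedSpeed_apply {g : ℝ → ℝ}
    (hg : IsCoordinateTransformation g) (t : ℝ) : augmentedSpeed g (g t) = deriv g t := by
  have h := hg.mem_Ioo t
  rw [augmentedSpeed, if_neg (not_le.2 h.1), if_neg (not_le.2 h.2), inverseTransformation,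
    Function.leftInverse_invFun hg.strictMono.injective]

lemma cylinder_mono {E : Type*} [NormedAddCommGroup E] (η : E) {ρ R : ℝ} (h : ρ ≤ R) :
    cylinder η ρ ⊆ cylinder η R :=
  prod_mono (Metric.closedBall_subset_closedBall h) (Icc_subset_Icc_right (by linarith))

lemma convex_cylinder {E : Type*} [NormedAddCommGroup E] [NormedSpace ℝ E] (η : E) (R : ℝ) :
    Convex ℝ (cylinder η R) :=
  (convex_closedBall η R).prod (convex_Icc _ _)

lemma norm_sub_le_of_mem_cylinder {E : Type*} [NormedAddCommGroup E] {η : E} {R : ℝ} {p : E × ℝ}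
    (hp : p ∈ cylinder η R) : ‖p - (η, -1)‖ ≤ R := by
  refine max_le (mem_closedBall_iff_norm.1 hp.1) ?_
  rw [Prod.snd_sub, sub_neg_eq_add, Real.norm_eq_abs, abs_of_nonneg (by linarith [hp.2.1])]
  linarith [hp.2.2]

lemma exists_cylinder_subset {E : Type*} [NormedAddCommGroup E] {U : Set E} (hU : IsOpen U) {η : E} (hη : η ∈ U) :
    ∃ R > 0, cylinder η R ⊆ U ×ˢ Icc (-1 : ℝ) 1 := by
  obtain ⟨r, hr, hrU⟩ := Metric.nhds_basis_closedBall.mem_iff.1 (hU.mem_nhds hη)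
  refine ⟨min r 2, by positivity, prod_mono ?_ (Icc_subset_Icc_right ?_)⟩
  · exact (Metric.closedBall_subset_closedBall (min_le_left _ _)).trans hrU
  · linarith [min_le_right r 2]

section Linearization

variable {E : Type*} [NormedAddCommGroup E] [NormedSpace ℝ E]

/-- A `C¹` field on `U × [-1, 1]` is strictly differentiable within the phase space at a boundary
point `(η, -1)`. -/
lemma exists_norm_sub_sub_le {F : E × ℝ → E × ℝ} {U : Set E} (hU : IsOpen U)
    (hF : ContDiffOn ℝ 1 F (U ×ˢ Icc (-1 : ℝ) 1)) {η : E} (hη : η ∈ U) {δ : ℝ} (hδ : 0 < δ) :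
    ∃ R > 0, ∀ p ∈ cylinder η R, ∀ q ∈ cylinder η R,
      ‖F p - F q - fderivWithin ℝ F (U ×ˢ Icc (-1 : ℝ) 1) (η, -1) (p - q)‖ ≤ δ * ‖p - q‖ := by
  have hud : UniqueDiffOn ℝ (U ×ˢ Icc (-1 : ℝ) 1) :=
    hU.uniqueDiffOn.prod (uniqueDiffOn_Icc (by norm_num))
  have hmem : ((η, -1) : E × ℝ) ∈ U ×ˢ Icc (-1 : ℝ) 1 := ⟨hη, by norm_num⟩
  have hcont := hF.continuousOn_fderivWithin hud le_rfl _ hmem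
  obtain ⟨r, hr, hrball⟩ := Metric.mem_nhdsWithin_iff.1
    (hcont.eventually (Metric.closedBall_mem_nhds _ hδ))
  obtain ⟨R, hR, hRU⟩ := exists_cylinder_subset hU hη
  have hsub : cylinder η (min R (r / 2)) ⊆ U ×ˢ Icc (-1 : ℝ) 1 :=
    (cylinder_mono η (min_le_left _ _)).trans hRU
  refine ⟨min R (r / 2), by positivity, fun p hp q hq => ?_⟩
  refine (convex_cylinder η _).norm_image_sub_le_of_norm_hasFDerivWithin_le'
    (f' := fderivWithin ℝ F (U ×ˢ Icc (-1 : ℝ) 1)) (fun z hz => ?_) (fun z hz => ?_) hq hp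
  · exact ((hF.differentiableOn one_ne_zero) z (hsub hz)).hasFDerivWithinAt.mono hsub
  · have h1 : z ∈ Metric.ball ((η, -1) : E × ℝ) r := by
      rw [mem_ball_iff_norm]
      linarith [norm_sub_le_of_mem_cylinder hz, min_le_right R (r / 2)]
    have h2 := hrball ⟨h1, hsub hz⟩
    exact mem_closedBall_iff_norm.1 h2

/-- If the second component of the field depends on the second coordinate only and vanishes to
first order at `-1`, it has a small Lipschitz constant near `-1`. -/
lemma abs_snd_sub_le {F : E × ℝ → E × ℝ} {J : E × ℝ →L[ℝ] E × ℝ} {γ : ℝ → ℝ} {η : E} {R δ : ℝ}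
    (hR : 0 ≤ R) (hF2 : ∀ p, (F p).2 = γ p.2) (hJ : ∀ p, (J p).2 = 0)
    (h : ∀ p ∈ cylinder η R, ∀ q ∈ cylinder η R, ‖F p - F q - J (p - q)‖ ≤ δ * ‖p - q‖) :
    ∀ p ∈ cylinder η R, ∀ q ∈ cylinder η R, |(F p - F q).2| ≤ δ * |(p - q).2| := by
  intro p hp q hq
  have h1 := h (η, p.2) ⟨Metric.mem_closedBall_self hR, hp.2⟩ (η, q.2)
    ⟨Metric.mem_closedBall_self hR, hq.2⟩
  have h2 := (norm_snd_le _).trans h1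
  rw [Prod.snd_sub, Prod.snd_sub, hJ, hF2, hF2, sub_zero, Prod.mk_sub_mk, sub_self, Prod.norm_mk,
    norm_zero, max_eq_right (norm_nonneg _), Real.norm_eq_abs, Real.norm_eq_abs] at h2
  rwa [Prod.snd_sub, hF2, hF2, Prod.snd_sub]

/-- The rate `a / (‖B‖ + 1)` does not depend on `ε`: only the cone becomes thinner in smaller
cylinders. -/
lemma exists_isDissipativeOn {F : E × ℝ → E × ℝ} {B : E →L[ℝ] E →L[ℝ] ℝ} {v η : E} {A : E →ₗ[ℝ] E}
    {J : E × ℝ →L[ℝ] E × ℝ} {γ : ℝ → ℝ} {a : ℝ} (ha : 0 < a)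
    (hBA : ∀ x, B x (A x) ≤ -a * ‖x‖ ^ 2) (hJ : ∀ p, J p = (A (p.1 - p.2 • v), 0))
    (hF2 : ∀ p, (F p).2 = γ p.2)
    (hstrict : ∀ δ > 0, ∃ R > 0, ∀ p ∈ cylinder η R, ∀ q ∈ cylinder η R,
      ‖F p - F q - J (p - q)‖ ≤ δ * ‖p - q‖) {ε : ℝ} (hε : 0 < ε) :
    ∃ R > 0, IsDissipativeOn F (cylinder η R) B v (a / (‖B‖ + 1)) ε := by
  set M := (‖B‖ + 1) * (1 + ‖v‖) ^ 2 with hM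
  have hM1 : 1 ≤ M := by
    have h1 : 1 ≤ (1 + ‖v‖) ^ 2 := one_le_pow₀ (by linarith [norm_nonneg v])
    nlinarith [norm_nonneg B]
  have hMB : ‖B‖ * (1 + ‖v‖) ^ 2 ≤ M := by
    rw [hM]
    gcongr
    linarith
  obtain ⟨R, hR, h⟩ := hstrict (min (a / (3 * M)) (ε / M)) (by positivity)
  set δ := min (a / (3 * M)) (ε / M) with hδ
  have hδ0 : 0 ≤ δ := by positivity
  have hδa : 3 * M * δ ≤ a := by
    have := min_le_left (a / (3 * M)) (ε / M)
    rwa [← hδ, le_div_iff₀ (by positivity), mul_comm] at this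
  have hδε : M * δ ≤ ε := by
    have := min_le_right (a / (3 * M)) (ε / M)
    rwa [← hδ, le_div_iff₀ (by positivity), mul_comm] at this
  have h1 : ‖B‖ * (1 + ‖v‖) ^ 2 * δ ≤ M * δ := by gcongr
  refine ⟨R, hR, isDissipativeOn_of_norm_sub_le (J := (J : E × ℝ →ₗ[ℝ] E × ℝ)) ha hBA hJ hδ0
    (by linarith) (by linarith) (by nlinarith) h ?_⟩
  exact abs_snd_sub_le hR.le hF2 (fun p => by rw [hJ]) h

end Linearization

section

variable {n d : ℕ} {U : Set (EuclideanSpace ℝ (Fin n))}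
  {f : EuclideanSpace ℝ (Fin n) → EuclideanSpace ℝ (Fin d) → EuclideanSpace ℝ (Fin n)}
  {Γ : ℝ → EuclideanSpace ℝ (Fin d)} {Γm Γp : EuclideanSpace ℝ (Fin d)} {g : ℝ → ℝ}
  {η : EuclideanSpace ℝ (Fin n)}

lemma compactifiedField_neg_one (x : EuclideanSpace ℝ (Fin n)) :
    compactifiedField f g Γ Γm Γp (x, -1) = (f x Γm, 0) := by
  simp [compactifiedField, extendedGamma, augmentedSpeed]

lemma jacobianAt_compactifiedField_apply (hU : IsOpen U) (hη : η ∈ U)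
    (hC1 : ContDiffOn ℝ 1 (compactifiedField f g Γ Γm Γp) (extendedPhaseSpace U))
    (w : EuclideanSpace ℝ (Fin n)) :
    jacobianAt (compactifiedField f g Γ Γm Γp) (extendedPhaseSpace U) (η, -1) (w, 0) =
      (jacobianAt (fun x => f x Γm) U η w, 0) := by
  have hmem : ((η, -1) : EuclideanSpace ℝ (Fin n) × ℝ) ∈ extendedPhaseSpace U :=
    ⟨hη, by norm_num⟩
  have h1 := ((hC1.differentiableOn one_ne_zero) _ hmem).hasFDerivWithinAt
  have h2 : HasFDerivWithinAt (fun x : EuclideanSpace ℝ (Fin n) => (x, (-1 : ℝ)))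
      (ContinuousLinearMap.inl ℝ (EuclideanSpace ℝ (Fin n)) ℝ) U η :=
    (hasFDerivAt_prodMk_left η (-1 : ℝ)).hasFDerivWithinAt
  have h3 := HasFDerivWithinAt.comp (t := extendedPhaseSpace U) η h1 h2
    (fun x hx => ⟨hx, by norm_num⟩)
  have h4 : compactifiedField f g Γ Γm Γp ∘ (fun x => (x, (-1 : ℝ))) = fun x => (f x Γm, 0) :=
    funext fun x => compactifiedField_neg_one x
  rw [h4] at h3
  have hud := hU.uniqueDiffWithinAt (𝕜 := ℝ) hη
  have h5 := h3.fst.fderivWithin hud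
  have h6 := hud.eq h3.snd (hasFDerivWithinAt_const (0 : ℝ) η U)
  ext1
  · exact (DFunLike.congr_fun h5 w).symm
  · exact DFunLike.congr_fun h6 w

end

end Compactification

theorem theorem3p2 {n d : ℕ}
    (U : Set (EuclideanSpace ℝ (Fin n))) (V : Set (EuclideanSpace ℝ (Fin d)))
    (hU : IsOpen U) (hV : IsOpen V)
    (f : EuclideanSpace ℝ (Fin n) → EuclideanSpace ℝ (Fin d) → EuclideanSpace ℝ (Fin n))
    (hf : ContDiffOn ℝ 1 (Function.uncurry f) (U ×ˢ V))
    (Γ : ℝ → EuclideanSpace ℝ (Fin d)) (hΓ : ContDiff ℝ 1 Γ) (hΓV : ∀ t, Γ t ∈ V)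
    (Γm Γp : EuclideanSpace ℝ (Fin d)) (hΓm : Γm ∈ V) (hΓp : Γp ∈ V)
    (hlimm : Tendsto Γ atBot (𝓝 Γm)) (hlimp : Tendsto Γ atTop (𝓝 Γp))
    (g : ℝ → ℝ) (hg : IsCoordinateTransformation g)
    (hC1 : ContDiffOn ℝ 1 (compactifiedField f g Γ Γm Γp) (extendedPhaseSpace U))
    (η : EuclideanSpace ℝ (Fin n))
    (hsink : IsHyperbolicSink (fun x => f x Γm) U η)
    (hnonhyp : IsNonhyperbolicEquilibrium (compactifiedField f g Γ Γm Γp)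
      (extendedPhaseSpace U) (η, -1)) :
    ∀ O : Set (EuclideanSpace ℝ (Fin n) × ℝ), IsOpen O → (η, -1) ∈ O →
      ∃ N : Set (EuclideanSpace ℝ (Fin n) × ℝ), IsOpen N ∧ (η, -1) ∈ N ∧ N ⊆ O ∧
        (∃! W : Set (EuclideanSpace ℝ (Fin n) × ℝ),
          IsLocalCentreManifold (compactifiedField f g Γ Γm Γp) (extendedPhaseSpace U)
            (η, -1) N W) ∧
        ∀ W : Set (EuclideanSpace ℝ (Fin n) × ℝ),
          IsLocalCentreManifold (compactifiedField f g Γ Γm Γp) (extendedPhaseSpace U)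
            (η, -1) N W →
          W = localUnstableSet (compactifiedField f g Γ Γm Γp) (extendedPhaseSpace U)
            {(η, -1)} N := by
  intro O hO hηO
  obtain ⟨hηU, -, hA⟩ := hsink
  obtain ⟨-, hF0, μ, hμ, hμre⟩ := hnonhyp
  have hJA := jacobianAt_compactifiedField_apply hU hηU hC1
  set A := jacobianAt (fun x => f x Γm) U η
  set F := compactifiedField f g Γ Γm Γp with hF
  set P := extendedPhaseSpace U with hP
  -- The linearization in the coordinates `(x - s v, s)`.
  have hJ2 := snd_eq_zero_of_isComplexEigenvalue (fun μ hμ => (hA μ hμ).ne) hJA hμ hμre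
  obtain ⟨v, hv⟩ := surjective_of_isComplexEigenvalue_re_neg hA (-(jacobianAt F P (η, -1) (0, 1)).1)
  have hJ : ∀ p, jacobianAt F P (η, -1) p = (A (p.1 - p.2 • v), 0) := by
    intro p
    refine Prod.ext ?_ (hJ2 p)
    have : p = (p.1, 0) + p.2 • ((0 : EuclideanSpace ℝ (Fin n)), (1 : ℝ)) := by ext <;> simp
    rw [this, map_add, map_smul, hJA]
    simp [hv]
  obtain ⟨B, a, ha, hsymm, hcoer, hBA⟩ := exists_lyapunov_form A hA
  have hF2 : ∀ p, (F p).2 = augmentedSpeed g p.2 := fun p => rfl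
  have hstrict : ∀ δ > 0, ∃ R > 0, ∀ p ∈ cylinder η R, ∀ q ∈ cylinder η R,
      ‖F p - F q - fderivWithin ℝ F P (η, -1) (p - q)‖ ≤ δ * ‖p - q‖ := fun δ hδ =>
    exists_norm_sub_sub_le hU hC1 hηU hδ
  have hdiss : ∀ ε > 0, ∃ R > 0, IsDissipativeOn F (cylinder η R) B v (a / (‖B‖ + 1)) ε :=
    fun ε hε => exists_isDissipativeOn ha hBA hJ hF2 hstrict hε
  set κ := a / (‖B‖ + 1) with hκ
  have hκ0 : 0 < κ := by positivity
  obtain ⟨R₁, hR₁, hdiss₁⟩ := hdiss (κ / 4) (by positivity)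
  obtain ⟨R₂, hR₂, hstrict₂⟩ := hstrict 1 one_pos
  obtain ⟨R₃, hR₃, hsub₃⟩ := exists_cylinder_subset hU hηU
  obtain ⟨r, hr, hrO⟩ := Metric.isOpen_iff.1 hO _ hηO
  obtain ⟨R, hR, hRR₁, hRR₂, hRR₃, hRr⟩ : ∃ R > 0, R ≤ R₁ ∧ R ≤ R₂ ∧ R ≤ R₃ ∧ R ≤ r :=
    ⟨min (min R₁ R₂) (min R₃ r), by positivity, (min_le_left _ _).trans (min_le_left _ _),
      (min_le_left _ _).trans (min_le_right _ _), (min_le_right _ _).trans (min_le_left _ _),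
      (min_le_right _ _).trans (min_le_right _ _)⟩
  have hheight : 0 < R / 4 / (1 + ‖v‖) := by positivity
  obtain ⟨T, hT⟩ := (hg.tendsto_atBot.eventually_lt_const
    (u := -1 + R / 4 / (1 + ‖v‖)) (by linarith)).exists
  have h : IsDissipativeSkewProduct F P B v η κ g R T :=
    { symm := hsymm
      coercive := hcoer
      κ_pos := hκ0
      R_pos := hR
      dissipative := hdiss₁.mono (cylinder_mono η hRR₁)
      lipschitz := by
        refine ⟨‖fderivWithin ℝ F P (η, -1)‖₊ + 1, LipschitzOnWith.of_dist_le_mul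
          fun p hp q hq => ?_⟩
        have h1 := hstrict₂ p (cylinder_mono η hRR₂ hp) q (cylinder_mono η hRR₂ hq)
        have h2 := (fderivWithin ℝ F P (η, -1)).le_opNorm (p - q)
        have h3 := norm_le_norm_sub_add (F p - F q) (fderivWithin ℝ F P (η, -1) (p - q))
        rw [dist_eq_norm, dist_eq_norm]
        push_cast
        linarith
      map_base := hF0
      cylinder_subset := (cylinder_mono η hRR₃).trans hsub₃
      neg_one_le := fun p hp => hp.2.1
      hasDerivAt := fun x t => by
        rw [hF2, hg.augmentedSpeed_apply]
        exact ((hg.contDiff.differentiable two_ne_zero) t).hasDerivAt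
      neg_one_lt := fun t => (hg.mem_Ioo t).1
      strictMono := hg.strictMono
      tendsto := hg.tendsto_atBot
      height_le := by
        rw [← le_div_iff₀ (by positivity)]
        linarith }
  have hc : ∀ p, p ∈ centreSubspace (jacobianAt F P (η, -1)) ↔ p.1 = p.2 • v := fun p =>
    mem_centreSubspace_iff hA hJ
  have hsu : ∀ p, p ∈ stableSubspace (jacobianAt F P (η, -1)) ⊔
      unstableSubspace (jacobianAt F P (η, -1)) ↔ p.2 = 0 := fun p =>
    mem_stable_sup_unstable_iff hA hJ
  refine ⟨tube B v η (R / 4) (g T + 1), isOpen_tube _ _ _ _ _, h.base_mem_tube, fun p hp => ?_,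
    ⟨_, IsDissipativeSkewProduct.isLocalCentreManifold_backwardSet hc hsu h hdiss, fun W hW => ?_⟩,
    fun W hW => ?_⟩
  · refine hrO (mem_ball_iff_norm.2 ?_)
    linarith [h.norm_sub_le_of_mem_tube hp]
  · exact IsDissipativeSkewProduct.eq_backwardSet_of_isLocalCentreManifold hc hsu h hW
  · rw [← h.backwardSet_eq_localUnstableSet]
    exact IsDissipativeSkewProduct.eq_backwardSet_of_isLocalCentreManifold hc hsu h hW
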